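/- **Theorem 4.4.** Let $(M,g)$ be a smooth Riemannian manifold with Levi-Civita connection $\widetilde\nabla$, and let $F$ be a smooth tensor field of type $(1,1)$ on $M$ such that $g(FX,Y)+g(X,FY)=0$ for all tangent vectors $X,Y$ at a common point, $F_x:T_xM\to T_xM$ is bijective for every $x\in M$, and $\widetilde\nabla F=0$. (That is, $M$ is a nondegenerate $(g,F,\mu=+1)$-manifold with parallel $F$.) Let $N$ be an immersed submanifold of $M$ with the induced metric, identify $T_xN$ with its image in $T_xM$, and let $T_x^{\perp}N$ be its orthogonal complement. Let $D$ be a smooth distribution (a smooth vector subbundle of $TN$) which makes $N$ a semi-invariant submanifold; that is, with $D^{\perp}$ the orthogonal complement of $D$ in $TN$: 1. $F(D_x)\subset D_x$ for all $x\in N$; 2. $F(D_x^{\perp})\subset T_x^{\perp}N$ for all $x\in N$; 3. $F^2(D^{\perp})$ is a smooth distribution on $N$. Then the $F$-anti-invariant distribution $D^{\perp}$ is integrable: the Lie bracket of any two smooth (local) sections of $D^{\perp}$ is a section of $D^{\perp}$, and $D^{\perp}$ is tangent to a foliation of $N$, i.e. around every point of $N$ there is a smooth chart $\varphi:U\to\mathbb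 R^{n}$ ($n=\dim N$) and a linear subspace $K\subset\mathbb R^{n}$ such that $D^{\perp}_x=(d\varphi_x)^{-1}(K)$ for all $x\in U$. -/

import Mathlib

open scoped Manifold ContDiff Bundle InnerProductSpace

noncomputable section

namespace AffinorGeometry

section Distributions

variable {E : Type*} [NormedAddCommGroup E] [NormedSpace ℝ E]
  {H : Type*} [TopologicalSpace H] (I : ModelWithCorners ℝ E H)
  {N : Type*} [TopologicalSpace N] [ChartedSpace H N] [IsManifold I ∞ N]

/-- A field of tangent subspaces `x ↦ D x` is a smooth distribution (a smooth vector subbundle of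
`TN`) if near every point it is spanned by a smooth frame. The rank is then locally constant. -/
def IsDistribution (D : ∀ x : N, Submodule ℝ (TangentSpace I x)) : Prop :=
  ∀ x₀ : N, ∃ U : Set N, IsOpen U ∧ x₀ ∈ U ∧
    ∃ (k : ℕ) (s : Fin k → ∀ x : N, TangentSpace I x),
      (∀ i, CMDiff[U] ∞ (T% (s i))) ∧
      ∀ x ∈ U, LinearIndependent ℝ (fun i ↦ s i x) ∧
        Submodule.span ℝ (Set.range fun i ↦ s i x) = D x

/-- `D` is involutive: the Lie bracket of two smooth (local) sections of `D` is a section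
of `D`. -/
def IsInvolutive (D : ∀ x : N, Submodule ℝ (TangentSpace I x)) : Prop :=
  ∀ (U : Set N) (X Y : ∀ x : N, TangentSpace I x), IsOpen U →
    CMDiff[U] ∞ (T% X) → CMDiff[U] ∞ (T% Y) →
    (∀ x ∈ U, X x ∈ D x) → (∀ x ∈ U, Y x ∈ D x) →
    ∀ x ∈ U, VectorField.mlieBracket I X Y x ∈ D x

end Distributions

/-- `D` is (completely) integrable, that is, tangent to a foliation of `N`: the manifold is covered
by smooth foliated charts, i.e. charts `φ` whose differential carries `D` to a constant subspace `K`
of the model space, so that the plaques `φ ⁻¹' (a + K)` are integral manifolds of `D`. -/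
def IsIntegrable {n : ℕ} {N : Type*} [TopologicalSpace N]
    [ChartedSpace (EuclideanSpace ℝ (Fin n)) N] [IsManifold (𝓡 n) ∞ N]
    (D : ∀ x : N, Submodule ℝ (TangentSpace (𝓡 n) x)) : Prop :=
  ∀ x₀ : N, ∃ φ ∈ IsManifold.maximalAtlas (𝓡 n) ∞ N, x₀ ∈ φ.source ∧
    ∃ K : Submodule ℝ (EuclideanSpace ℝ (Fin n)), ∀ x ∈ φ.source,
      ∀ v : TangentSpace (𝓡 n) x,
        v ∈ D x ↔ (mfderiv (𝓡 n) (𝓡 n) φ x v : EuclideanSpace ℝ (Fin n)) ∈ K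

section Affinors

variable {E : Type*} [NormedAddCommGroup E] [NormedSpace ℝ E]
  {H : Type*} [TopologicalSpace H] {I : ModelWithCorners ℝ E H}
  {M : Type*} [TopologicalSpace M] [ChartedSpace H M] [IsManifold I ∞ M]

/-- `F` is an affinor: a smooth tensor field of type `(1,1)`. -/
def IsAffinor (F : ∀ x : M, TangentSpace I x →L[ℝ] TangentSpace I x) : Prop :=
  ContMDiff I (I.prod 𝓘(ℝ, E →L[ℝ] E)) ∞
    (fun x ↦ Bundle.TotalSpace.mk' (E →L[ℝ] E)
      (E := fun x : M ↦ TangentSpace I x →L[ℝ] TangentSpace I x) x (F x))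

/-- The affinor is nondegenerate at every point. -/
def IsNondegenerate (F : ∀ x : M, TangentSpace I x →L[ℝ] TangentSpace I x) : Prop :=
  ∀ x : M, Function.Bijective (F x)

/-- The tensor field `F` is parallel for the connection `∇`, i.e. `∇F = 0`:
`∇_v (F X) = F (∇_v X)` for every tangent vector `v` and every vector field `X`. -/
def IsParallel [FiniteDimensional ℝ E]
    (nabla : CovariantDerivative I E (TangentSpace I : M → Type _))
    (F : ∀ x : M, TangentSpace I x →L[ℝ] TangentSpace I x) : Prop :=
  ∀ (x : M) (X : ∀ y : M, TangentSpace I y), MDiffAt (T% X) x →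
    ∀ v : TangentSpace I x, nabla (fun y ↦ F y (X y)) x v = F x (nabla X x v)

variable [Bundle.RiemannianBundle (fun x : M ↦ TangentSpace I x)]

/-- The compatibility `g(FX, Y) + μ g(X, FY) = 0` defining a `(g, F, μ)`-manifold. -/
def IsAffinorMetric (F : ∀ x : M, TangentSpace I x →L[ℝ] TangentSpace I x) (μ : ℝ) : Prop :=
  ∀ (x : M) (X Y : TangentSpace I x), inner ℝ (F x X) Y + μ * inner ℝ X (F x Y) = 0

/-- `∇` is the Levi-Civita connection of the Riemannian metric: torsion-free and metric. -/
def IsLeviCivita [FiniteDimensional ℝ E]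
    [IsContMDiffRiemannianBundle I ∞ E (fun x : M ↦ TangentSpace I x)]
    (nabla : CovariantDerivative I E (TangentSpace I : M → Type _)) : Prop :=
  nabla.torsion = 0 ∧
    CovariantDerivative.IsMetricCompatible (V := fun x : M ↦ TangentSpace I x) (F := E) nabla

end Affinors

section Submanifolds

variable {E : Type*} [NormedAddCommGroup E] [NormedSpace ℝ E]
  {H : Type*} [TopologicalSpace H] {I : ModelWithCorners ℝ E H}
  {M : Type*} [TopologicalSpace M] [ChartedSpace H M] [IsManifold I ∞ M]
  [Bundle.RiemannianBundle (fun x : M ↦ TangentSpace I x)]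
  {E' : Type*} [NormedAddCommGroup E'] [NormedSpace ℝ E']
  {H' : Type*} [TopologicalSpace H'] (J : ModelWithCorners ℝ E' H')
  {N : Type*} [TopologicalSpace N] [ChartedSpace H' N] [IsManifold J ∞ N]

variable (I) in
/-- The differential `T_xN → T_{ι x}M` of the immersion `ι`, as a linear map. -/
def dmap (ι : N → M) (x : N) : TangentSpace J x →ₗ[ℝ] TangentSpace I (ι x) :=
  (mfderiv J I ι x).toLinearMap

variable (I) in
/-- The normal space of the submanifold `ι : N → M` at `x`, a subspace of `T_{ι x}M`. -/
def normalSpace (ι : N → M) (x : N) : Submodule ℝ (TangentSpace I (ι x)) :=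
  (LinearMap.range (dmap I J ι x))ᗮ

variable (I) in
/-- The complementary orthogonal distribution `D^⊥` to `D` in `TN`, for the metric induced on `N`
by the immersion `ι`. -/
def orthDistribution (ι : N → M) (D : ∀ x : N, Submodule ℝ (TangentSpace J x)) (x : N) :
    Submodule ℝ (TangentSpace J x) :=
  (((D x).map (dmap I J ι x))ᗮ).comap (dmap I J ι x)

/-- The distribution `D` makes the immersed submanifold `ι : N → M` semi-invariant. -/
structure IsSemiInvariant (F : ∀ x : M, TangentSpace I x →L[ℝ] TangentSpace I x)
    (ι : N → M) (D : ∀ x : N, Submodule ℝ (TangentSpace J x)) : Prop where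
  isDistribution : IsDistribution J D
  /-- `D` is `F`-invariant. -/
  invariant : ∀ x : N,
    ((D x).map (dmap I J ι x)).map (F (ι x)).toLinearMap ≤ (D x).map (dmap I J ι x)
  /-- `D^⊥` is `F`-anti-invariant. -/
  antiInvariant : ∀ x : N,
    ((orthDistribution I J ι D x).map (dmap I J ι x)).map (F (ι x)).toLinearMap
      ≤ normalSpace I J ι x
  /-- `F² (D^⊥)` is a distribution on `N`. -/
  sq_isDistribution : ∃ D' : ∀ x : N, Submodule ℝ (TangentSpace J x), IsDistribution J D' ∧
    ∀ x : N, (((orthDistribution I J ι D x).map (dmap I J ι x)).map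
      (F (ι x)).toLinearMap).map (F (ι x)).toLinearMap = (D' x).map (dmap I J ι x)

end Submanifolds

end AffinorGeometry

end

/-!
The tensor `Ω(X, Y) = g(X, F Y)` is skew because `g(FX, Y) + g(X, FY) = 0`, and it is closed because
`F` is parallel for a torsion-free metric connection (`fderiv_fundamentalForm_cyclic`). On a
semi-invariant submanifold `ι : N → M`, the distribution `D^⊥` is exactly the kernel of the two-form
`ι^*Ω` (`mem_orthDistribution_iff_inner_affinor`): `F(D^⊥)` is normal to `N`, and conversely a
vector of the kernel is orthogonal to `F(D)`, which equals `D` since `F` is injective. The kernel of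
a closed two-form is involutive (`apply_fderiv_lieBracket_eq_zero`), so `D^⊥` is involutive
(`isInvolutive_orthDistribution`).

Integrability is the Frobenius theorem. A local frame `s_i` of `D` gives one-forms
`w ↦ g(dι s_i, dι w)`, linearly independent since `dι` is injective, whose common kernel is `D^⊥`
(`mem_orthDistribution_iff_coframe`). In a chart split as `K × L`, this kernel is the graph of a
smooth family of linear maps `A(u, y) : K → L`, and involutivity becomes the integrability
condition of the total differential equation `∂y/∂u = A(u, y)`. The equation is solved along the
rays from `0`: its integral form is an equation in the Banach space `C([0, 1], L)` depending
smoothly on the direction `u` and the initial value, so the inverse function theorem gives a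
solution depending smoothly on all data (`exists_straightening_of_graph`). That this radial solution
solves the full equation follows from uniqueness for a linear differential equation
(`eq_smul_of_linearised`). The leaves `y = y(u; z)` straighten the distribution
(`exists_straightening_of_ker`, `isIntegrable_of_isInvolutive`).
-/

noncomputable section

open scoped Topology
open Set Filter

-- The value Mathlib itself uses; instances on spaces of continuous linear maps depend on it.
set_option maxSynthPendingDepth 3
set_option linter.unusedSectionVars false

namespace AffinorGeometry

/-! ### Smoothness of superposition operators on spaces of continuous functions -/

section Superposition

universe u

variable {X : Type*} [TopologicalSpace X] [CompactSpace X]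

/-- The continuous bilinear map on spaces of continuous functions induced pointwise by a continuous
bilinear map `B`, sending `g` and `h` to `t ↦ B (g t) (h t)`. -/
def pointwiseBilin (X : Type*) [TopologicalSpace X] [CompactSpace X]
    {G E F : Type*} [NormedAddCommGroup G] [NormedSpace ℝ G] [NormedAddCommGroup E]
    [NormedSpace ℝ E] [NormedAddCommGroup F] [NormedSpace ℝ F] (B : G →L[ℝ] E →L[ℝ] F) :
    C(X, G) →L[ℝ] C(X, E) →L[ℝ] C(X, F) :=
  LinearMap.mkContinuous₂
    (LinearMap.mk₂ ℝ
      (fun (g : C(X, G)) (h : C(X, E)) ↦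
        (⟨fun t ↦ B (g t) (h t), (B.continuous.comp g.continuous).clm_apply h.continuous⟩ :
          C(X, F)))
      (fun _ _ _ ↦ by ext; simp) (fun _ _ _ ↦ by ext; simp)
      (fun _ _ _ ↦ by ext; simp) (fun _ _ _ ↦ by ext; simp)) ‖B‖ (by
    intro g h
    refine (ContinuousMap.norm_le _ (by positivity)).2 fun t ↦ ?_
    exact (B.le_opNorm₂ _ _).trans
      (mul_le_mul (mul_le_mul_of_nonneg_left (g.norm_coe_le_norm t) (norm_nonneg _))
        (h.norm_coe_le_norm t) (norm_nonneg _) (by positivity)))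

variable {E F G : Type*} [NormedAddCommGroup E] [NormedSpace ℝ E]
  [NormedAddCommGroup F] [NormedSpace ℝ F] [NormedAddCommGroup G] [NormedSpace ℝ G]

@[simp]
lemma pointwiseBilin_apply (B : G →L[ℝ] E →L[ℝ] F) (g : C(X, G)) (h : C(X, E)) (t : X) :
    pointwiseBilin X B g h t = B (g t) (h t) := rfl

/-- The embedding of `E` into `C(X, E)` as constant functions. -/
def constCLM (X : Type*) [TopologicalSpace X] [CompactSpace X]
    (E : Type*) [NormedAddCommGroup E] [NormedSpace ℝ E] : E →L[ℝ] C(X, E) :=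
  LinearMap.mkContinuous
    { toFun := fun e ↦ ContinuousMap.const X e
      map_add' := fun _ _ ↦ by ext; simp
      map_smul' := fun _ _ ↦ by ext; simp } 1 (by
    intro e
    rw [one_mul]
    exact (ContinuousMap.norm_le _ (by positivity)).2 fun t ↦ le_rfl)

@[simp]
lemma constCLM_apply (e : E) (t : X) : constCLM X E e t = e := rfl

/-- Composition `y ↦ f ∘ y` with a `C¹` map is differentiable on `C(X, E)`, by the mean value
inequality and uniform continuity of `Df` along the compact set `y(X)`. -/
lemma hasFDerivAt_superposition {f : E → F} (hf : Continuous f) {f' : E → G}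
    (hf' : Continuous f') (B : G →L[ℝ] E →L[ℝ] F) (hff' : ∀ x, HasFDerivAt f (B (f' x)) x)
    (y : C(X, E)) :
    HasFDerivAt (fun y : C(X, E) ↦ (⟨f, hf⟩ : C(E, F)).comp y)
      (pointwiseBilin X B ((⟨f', hf'⟩ : C(E, G)).comp y)) y := by
  rw [hasFDerivAt_iff_isLittleO_nhds_zero, Asymptotics.isLittleO_iff]
  intro ε hε
  have hcomp : IsCompact (range y) := isCompact_range y.continuous
  have := hcomp.uniformContinuousAt_of_continuousAt (fun x ↦ B (f' x))
    (fun a _ ↦ (B.continuous.comp hf').continuousAt)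
    (Metric.dist_mem_uniformity hε)
  obtain ⟨δ, hδ, hδ'⟩ := Metric.mem_uniformity_dist.1 this
  filter_upwards [Metric.ball_mem_nhds (0 : C(X, E)) hδ] with h hh
  have hh' : ‖h‖ < δ := by simpa using hh
  refine (ContinuousMap.norm_le _ (by positivity)).2 fun t ↦ ?_
  have hbound : ∀ x ∈ Metric.ball (y t) δ, ‖B (f' x) - B (f' (y t))‖ ≤ ε := by
    intro x hx
    have := @hδ' (y t) x (by rw [dist_comm]; exact hx) (mem_range_self t)
    rw [← dist_eq_norm, dist_comm]
    exact le_of_lt this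
  have hmem : y t + h t ∈ Metric.ball (y t) δ := by
    simpa using (h.norm_coe_le_norm t).trans_lt hh'
  have key := (convex_ball (y t) δ).norm_image_sub_le_of_norm_hasFDerivWithin_le'
    (fun x _ ↦ (hff' x).hasFDerivWithinAt) hbound (Metric.mem_ball_self hδ) hmem
  rw [add_sub_cancel_left] at key
  exact key.trans (mul_le_mul_of_nonneg_left (h.norm_coe_le_norm t) hε.le)

lemma contDiff_superposition_nat {E : Type u} [NormedAddCommGroup E] [NormedSpace ℝ E] (n : ℕ) :
    ∀ {F : Type u} [NormedAddCommGroup F] [NormedSpace ℝ F] {f : E → F} (hf : ContDiff ℝ n f),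
      ContDiff ℝ n (fun y : C(X, E) ↦ (⟨f, hf.continuous⟩ : C(E, F)).comp y) := by
  induction n with
  | zero =>
    intro F _ _ f hf
    exact contDiff_zero.2 (ContinuousMap.continuous_postcomp _)
  | succ n ih =>
    intro F _ _ f hf
    obtain ⟨f', hf', hff'⟩ := contDiff_succ_iff_hasFDerivAt.1 (by exact_mod_cast hf)
    have hcd : ContDiff ℝ n (fun y : C(X, E) ↦
        pointwiseBilin X (ContinuousLinearMap.id ℝ (E →L[ℝ] F))
          ((⟨f', hf'.continuous⟩ : C(E, E →L[ℝ] F)).comp y)) :=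
      (pointwiseBilin X (ContinuousLinearMap.id ℝ (E →L[ℝ] F))).contDiff.comp (ih hf')
    have : ContDiff ℝ ((n : WithTop ℕ∞) + 1)
        (fun y : C(X, E) ↦ (⟨f, hf.continuous⟩ : C(E, F)).comp y) :=
      contDiff_succ_iff_hasFDerivAt.2 ⟨_, hcd,
        fun y ↦ hasFDerivAt_superposition hf.continuous hf'.continuous _ hff' y⟩
    exact_mod_cast this

/-- Composition `y ↦ f ∘ y` with a smooth map is smooth on `C(X, E)`. -/
lemma contDiff_superposition {E F : Type u} [NormedAddCommGroup E] [NormedSpace ℝ E]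
    [NormedAddCommGroup F] [NormedSpace ℝ F] {f : E → F} (hf : ContDiff ℝ ∞ f) :
    ContDiff ℝ ∞ (fun y : C(X, E) ↦ (⟨f, hf.continuous⟩ : C(E, F)).comp y) :=
  contDiff_infty.2 fun n ↦ contDiff_superposition_nat n (contDiff_infty.1 hf n)

end Superposition

/-! ### The smooth inverse function theorem on a neighbourhood -/

/-- The inverse function theorem for smooth maps, with smoothness of the inverse on a whole
neighbourhood: at a single point `ContDiffAt ℝ ∞` only gives, for each finite order, a neighbourhood
depending on this order. -/
lemma exists_smooth_openPartialHomeomorph {E F : Type*} [NormedAddCommGroup E] [NormedSpace ℝ E]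
    [CompleteSpace E] [NormedAddCommGroup F] [NormedSpace ℝ F] [CompleteSpace F]
    {f : E → F} {U : Set E} (hU : IsOpen U) (hf : ContDiffOn ℝ ∞ f U) {a : E} (ha : a ∈ U)
    (hfa : (fderiv ℝ f a).IsInvertible) :
    ∃ φ : OpenPartialHomeomorph E F, (φ : E → F) = f ∧ a ∈ φ.source ∧ φ.source ⊆ U ∧
      (∀ x ∈ φ.source, (fderiv ℝ f x).IsInvertible) ∧ ContDiffOn ℝ ∞ φ.symm φ.target := by
  obtain ⟨f', hf'⟩ := hfa
  have hda : ContDiffAt ℝ ∞ f a := hf.contDiffAt (hU.mem_nhds ha)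
  have hd : HasFDerivAt f (f' : E →L[ℝ] F) a := by
    rw [hf']; exact (hda.differentiableAt (by simp)).hasFDerivAt
  let ψ := hda.toOpenPartialHomeomorph f hd (by simp)
  have hψ : (ψ : E → F) = f := rfl
  have hcont : ContinuousOn (fderiv ℝ f) U := hf.continuousOn_fderiv_of_isOpen hU (by simp)
  let W := U ∩ fderiv ℝ f ⁻¹' range ((↑) : (E ≃L[ℝ] F) → E →L[ℝ] F)
  have hW : IsOpen W := hcont.isOpen_inter_preimage hU ContinuousLinearEquiv.isOpen
  refine ⟨ψ.restrOpen W hW, ?_, ?_, ?_, ?_, ?_⟩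
  · exact hψ
  · exact ⟨hda.mem_toOpenPartialHomeomorph_source hd (by simp), ha, f', hf'⟩
  · exact fun x hx ↦ hx.2.1
  · rintro x ⟨-, -, g, hg⟩
    exact ⟨g, hg⟩
  · intro y hy
    have hx := (ψ.restrOpen W hW).map_target hy
    obtain ⟨-, hxU, g, hg⟩ := hx
    have hx' : ContDiffAt ℝ ∞ f ((ψ.restrOpen W hW).symm y) := hf.contDiffAt (hU.mem_nhds hxU)
    refine ((ψ.restrOpen W hW).contDiffAt_symm hy (f₀' := g) ?_ hx').contDiffWithinAt
    rw [hg]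
    exact (hx'.differentiableAt (by simp)).hasFDerivAt

/-! ### The integral equation of a total differential equation -/

section TotalDifferentialEquation

open scoped unitInterval

universe u

/-- The primitive `t ↦ ∫₀ᵗ h` of a continuous function on the unit interval, as a continuous linear
operator. -/
def primitiveCLM (L : Type*) [NormedAddCommGroup L] [NormedSpace ℝ L] :
    C(I, L) →L[ℝ] C(I, L) :=
  have hc : ∀ h : C(I, L), Continuous fun s : ℝ ↦ h (projIcc 0 1 zero_le_one s) :=
    fun h ↦ h.continuous.comp continuous_projIcc
  LinearMap.mkContinuous
    { toFun := fun h ↦ ⟨fun t ↦ ∫ s in (0 : ℝ)..t, h (projIcc 0 1 zero_le_one s),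
        (intervalIntegral.continuous_primitive (fun _ _ ↦ (hc h).intervalIntegrable _ _) 0).comp
          continuous_subtype_val⟩
      map_add' := fun h h' ↦ by
        ext t
        exact intervalIntegral.integral_add ((hc h).intervalIntegrable _ _)
          ((hc h').intervalIntegrable _ _)
      map_smul' := fun c h ↦ by
        ext t
        exact intervalIntegral.integral_smul c _ } 1 (by
    intro h
    rw [one_mul]
    refine (ContinuousMap.norm_le _ (by positivity)).2 fun t ↦ ?_
    refine (intervalIntegral.norm_integral_le_of_norm_le_const
      fun s _ ↦ h.norm_coe_le_norm (projIcc 0 1 zero_le_one s)).trans ?_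
    have : |(t : ℝ) - 0| ≤ 1 := by
      rw [sub_zero, abs_of_nonneg t.2.1]; exact t.2.2
    exact mul_le_of_le_one_right (norm_nonneg _) this)

variable {K L : Type u} [NormedAddCommGroup K] [NormedSpace ℝ K]
  [NormedAddCommGroup L] [NormedSpace ℝ L]

/-- The curve `s ↦ (s u, y s)` over the segment from `0` to `u`, depending linearly on
`(u, y)`. -/
def rayCLM (K L : Type*) [NormedAddCommGroup K] [NormedSpace ℝ K]
    [NormedAddCommGroup L] [NormedSpace ℝ L] : K × C(I, L) →L[ℝ] C(I, K × L) :=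
  LinearMap.mkContinuous
    { toFun := fun p ↦ ⟨fun s ↦ ((s : ℝ) • p.1, p.2 s), by fun_prop⟩
      map_add' := fun p q ↦ by ext <;> simp
      map_smul' := fun c p ↦ by ext <;> simp [smul_comm c] } 1 (by
    intro p
    rw [one_mul]
    refine (ContinuousMap.norm_le _ (by positivity)).2 fun s ↦ ?_
    refine max_le ((norm_smul_le _ _).trans ?_ |>.trans (norm_fst_le p))
      ((p.2.norm_coe_le_norm s).trans (norm_snd_le p))
    refine mul_le_of_le_one_left (norm_nonneg _) ?_
    rw [Real.norm_of_nonneg s.2.1]; exact s.2.2)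

@[simp]
lemma rayCLM_apply (p : K × C(I, L)) (s : I) : rayCLM K L p s = ((s : ℝ) • p.1, p.2 s) := rfl

lemma norm_rayCLM_apply_le (p : K × C(I, L)) (s : I) : ‖rayCLM K L p s‖ ≤ ‖p‖ := by
  have h : ‖rayCLM K L‖ ≤ 1 := LinearMap.mkContinuous_norm_le _ zero_le_one _
  exact ((rayCLM K L p).norm_coe_le_norm s).trans
    (((rayCLM K L).le_of_opNorm_le h p).trans_eq (one_mul _))

variable {A : K × L → K →L[ℝ] L}

/-- The velocity `s ↦ A(s u, y s) u` prescribed along the segment from `0` to `u` by the total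
differential equation `∂y = A(·, y)`. -/
def velocity (hA : ContDiff ℝ ∞ A) (p : K × C(I, L)) : C(I, L) :=
  pointwiseBilin I (ContinuousLinearMap.id ℝ (K →L[ℝ] L))
    ((⟨A, hA.continuous⟩ : C(K × L, K →L[ℝ] L)).comp (rayCLM K L p)) (constCLM I K p.1)

lemma velocity_apply (hA : ContDiff ℝ ∞ A) (p : K × C(I, L)) (s : I) :
    velocity hA p s = A ((s : ℝ) • p.1, p.2 s) p.1 := rfl

/-- The map `(u, y) ↦ (u, y - ∫₀ A(s u, y s) u ds)`: its fibre over `(u, z)`, for a constant `z`,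
consists of the solutions with initial value `z` of the total differential equation restricted to
the segment from `0` to `u`. -/
def integralEquation (hA : ContDiff ℝ ∞ A) (p : K × C(I, L)) : K × C(I, L) :=
  (p.1, p.2 - primitiveCLM L (velocity hA p))

lemma contDiff_velocity (hA : ContDiff ℝ ∞ A) : ContDiff ℝ ∞ (velocity hA) := by
  have h1 : ContDiff ℝ ∞ fun p : K × C(I, L) ↦
      (⟨A, hA.continuous⟩ : C(K × L, K →L[ℝ] L)).comp (rayCLM K L p) :=
    (contDiff_superposition hA).comp (rayCLM K L).contDiff
  exact ((pointwiseBilin I (ContinuousLinearMap.id ℝ (K →L[ℝ] L))).contDiff.comp h1).clm_apply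
    ((constCLM I K).contDiff.comp contDiff_fst)

lemma contDiff_integralEquation (hA : ContDiff ℝ ∞ A) :
    ContDiff ℝ ∞ (integralEquation hA) :=
  contDiff_fst.prodMk (contDiff_snd.sub ((primitiveCLM L).contDiff.comp (contDiff_velocity hA)))

/-- The linearised velocity: the derivative of `velocity` at `p` in the direction `q`. -/
def velocityDeriv (hA : ContDiff ℝ ∞ A) (p q : K × C(I, L)) : C(I, L) :=
  ⟨fun t ↦ fderiv ℝ A (rayCLM K L p t) (rayCLM K L q t) p.1 + A (rayCLM K L p t) q.1, by
    have := (hA.continuous_fderiv (by simp))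
    have := hA.continuous
    fun_prop⟩

lemma velocityDeriv_apply (hA : ContDiff ℝ ∞ A) (p q : K × C(I, L)) (t : I) :
    velocityDeriv hA p q t =
      fderiv ℝ A (rayCLM K L p t) (rayCLM K L q t) p.1 + A (rayCLM K L p t) q.1 := rfl

lemma fderiv_velocity (hA : ContDiff ℝ ∞ A) (p q : K × C(I, L)) :
    fderiv ℝ (velocity hA) p q = velocityDeriv hA p q := by
  ext t
  have hd : DifferentiableAt ℝ (velocity hA) p := (contDiff_velocity hA).differentiable (by simp) p
  -- Both sides are computed after evaluation at `t`, a continuous linear map.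
  have h1 : HasFDerivAt (fun p ↦ velocity hA p t)
      ((ContinuousMap.evalCLM ℝ t).comp (fderiv ℝ (velocity hA) p)) p :=
    (ContinuousMap.evalCLM ℝ t : C(I, L) →L[ℝ] L).hasFDerivAt.comp p hd.hasFDerivAt
  have h2 : HasFDerivAt (fun p ↦ rayCLM K L p t)
      ((ContinuousMap.evalCLM ℝ t).comp (rayCLM K L)) p :=
    ((ContinuousMap.evalCLM ℝ t).comp (rayCLM K L)).hasFDerivAt
  have h3 : HasFDerivAt (fun p ↦ velocity hA p t) _ p :=
    ((hA.differentiable (by simp) (rayCLM K L p t)).hasFDerivAt.comp p h2).clm_apply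
      hasFDerivAt_fst
  have := congrArg (fun T : K × C(I, L) →L[ℝ] L ↦ T q) (h1.unique h3)
  refine this.trans ?_
  rw [velocityDeriv_apply, add_comm]
  rfl

lemma fderiv_integralEquation (hA : ContDiff ℝ ∞ A) (p q : K × C(I, L)) :
    fderiv ℝ (integralEquation hA) p q =
      (q.1, q.2 - primitiveCLM L (velocityDeriv hA p q)) := by
  have hd : DifferentiableAt ℝ (velocity hA) p := (contDiff_velocity hA).differentiable (by simp) p
  have h : HasFDerivAt (integralEquation hA) _ p :=
    hasFDerivAt_fst.prodMk
      (hasFDerivAt_snd.sub ((primitiveCLM L).hasFDerivAt.comp p hd.hasFDerivAt))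
  rw [h.fderiv, ← fderiv_velocity]
  rfl

lemma fderiv_integralEquation_zero (hA : ContDiff ℝ ∞ A) (hA0 : A 0 = 0) :
    fderiv ℝ (integralEquation hA) 0 = ContinuousLinearMap.id ℝ (K × C(I, L)) := by
  refine ContinuousLinearMap.ext fun q ↦ ?_
  rw [fderiv_integralEquation]
  have : velocityDeriv hA 0 q = 0 := by
    ext t
    have h0 : rayCLM K L 0 t = 0 := by simp
    rw [velocityDeriv_apply, h0, hA0]
    simp
  simp [this]

/-- **Radial solutions solve the total differential equation.** Let `y` solve
`y' = A(t u, y) u` and let `η` solve the equation obtained by differentiating in `u` in the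
direction `v`. If the integrability condition holds along the curve `(t u, y t)`, then
`η t = t A(t u, y t) v`: the difference of both sides solves a homogeneous linear equation. -/
lemma eq_smul_of_linearised [CompleteSpace L] (hA : ContDiff ℝ ∞ A)
    {u v : K} {z : L} {y η : C(I, L)}
    (hy : ∀ t, y t = z + primitiveCLM L (velocity hA (u, y)) t)
    (hη : η = primitiveCLM L (velocityDeriv hA (u, y) (v, η)))
    (hinv : ∀ t : I, ∀ a b : K,
      fderiv ℝ A (rayCLM K L (u, y) t) (a, A (rayCLM K L (u, y) t) a) b =
        fderiv ℝ A (rayCLM K L (u, y) t) (b, A (rayCLM K L (u, y) t) b) a) (t : I) :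
    η t = (t : ℝ) • A (rayCLM K L (u, y) t) v := by
  let pr : ℝ → I := projIcc 0 1 zero_le_one
  have hpr : ∀ (s : ℝ) (hs : s ∈ Icc (0 : ℝ) 1), pr s = ⟨s, hs⟩ :=
    fun s hs ↦ projIcc_of_mem zero_le_one hs
  set g : C(I, L) := velocity hA (u, y) with hg
  set k : C(I, L) := velocityDeriv hA (u, y) (v, η) with hk
  have hgc : Continuous fun s ↦ g (pr s) := g.continuous.comp continuous_projIcc
  have hkc : Continuous fun s ↦ k (pr s) := k.continuous.comp continuous_projIcc
  -- The curves extended to the real line.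
  let Y : ℝ → L := fun s ↦ z + ∫ r in (0 : ℝ)..s, g (pr r)
  let H : ℝ → L := fun s ↦ ∫ r in (0 : ℝ)..s, k (pr r)
  have hY : ∀ s : I, Y s = y s := fun s ↦ (hy s).symm
  have hH : ∀ s : I, H s = η s := fun s ↦ by rw [hη]; rfl
  have hYd : ∀ s, HasDerivAt Y (g (pr s)) s := fun s ↦
    (intervalIntegral.integral_hasDerivAt_right (hgc.intervalIntegrable _ _)
      (hgc.stronglyMeasurableAtFilter _ _) hgc.continuousAt).const_add z
  have hHd : ∀ s, HasDerivAt H (k (pr s)) s := fun s ↦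
    intervalIntegral.integral_hasDerivAt_right (hkc.intervalIntegrable _ _)
      (hkc.stronglyMeasurableAtFilter _ _) hkc.continuousAt
  let w : ℝ → L := fun s ↦ H s - s • A (s • u, Y s) v
  have hAd : ∀ x, HasFDerivAt A (fderiv ℝ A x) x := fun x ↦
    (hA.differentiable (by simp) x).hasFDerivAt
  have hwd : ∀ s, HasDerivAt w (k (pr s) -
      (s • fderiv ℝ A (s • u, Y s) (u, g (pr s)) v + A (s • u, Y s) v)) s := by
    intro s
    have h1 : HasDerivAt (fun s : ℝ ↦ (s • u, Y s)) (u, g (pr s)) s := by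
      simpa using ((hasDerivAt_id s).smul_const u).prodMk (hYd s)
    have h2 : HasDerivAt (fun s : ℝ ↦ A (s • u, Y s)) (fderiv ℝ A (s • u, Y s) (u, g (pr s))) s :=
      (hAd _).comp_hasDerivAt s h1
    have h3 : HasDerivAt (fun s : ℝ ↦ A (s • u, Y s) v)
        (fderiv ℝ A (s • u, Y s) (u, g (pr s)) v) s := by
      simpa using h2.clm_apply (hasDerivAt_const s v)
    have h4 := (hHd s).sub ((hasDerivAt_id s).smul h3)
    simp only [id_eq, one_smul] at h4
    exact h4
  let T : C(I, K × L →L[ℝ] K →L[ℝ] L) :=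
    ⟨fun s ↦ fderiv ℝ A (rayCLM K L (u, y) s),
      (hA.continuous_fderiv (by simp)).comp (rayCLM K L (u, y)).continuous⟩
  -- By the integrability condition, the derivative of `w` is `DA(0, w) u`.
  have hw' : ∀ s : I, k s - ((s : ℝ) • fderiv ℝ A ((s : ℝ) • u, Y s) (u, g s) v +
      A ((s : ℝ) • u, Y s) v) = T s (0, w s) u := by
    intro s
    have hinv' := hinv s u v
    have e1 : ((0 : K), w s) = ((s : ℝ) • v, η s) - (s : ℝ) • (v, A (rayCLM K L (u, y) s) v) := by
      ext
      · simp
      · simp [w, hH, hY]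
    have e2 : T s = fderiv ℝ A (rayCLM K L (u, y) s) := rfl
    rw [e1, map_sub, map_smul, e2]
    simp only [sub_apply, smul_apply]
    rw [← hinv', hY, hk, velocityDeriv_apply, hg, velocity_apply]
    simp only [rayCLM_apply]
    abel
  have hw0 : ∀ x ∈ Icc (0 : ℝ) 1, w x = 0 := by
    refine eq_zero_of_abs_deriv_le_mul_abs_self_of_eq_zero_right (K := ‖T‖ * ‖u‖)
      (fun s _ ↦ (hwd s).continuousAt.continuousWithinAt)
      (fun s _ ↦ (hwd s).hasDerivWithinAt) (by simp [w, H]) ?_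
    intro s hs
    have hs' : s ∈ Icc (0 : ℝ) 1 := ⟨hs.1, hs.2.le⟩
    rw [hpr s hs', hw' ⟨s, hs'⟩]
    refine ((T ⟨s, hs'⟩ (0, w s)).le_opNorm u).trans ?_
    have h1 : ‖T ⟨s, hs'⟩ (0, w s)‖ ≤ ‖T‖ * ‖w s‖ := by
      refine ((T ⟨s, hs'⟩).le_opNorm _).trans ?_
      have : ‖((0 : K), w s)‖ = ‖w s‖ := by simp [Prod.norm_def]
      rw [this]
      exact mul_le_mul_of_nonneg_right (T.norm_coe_le_norm _) (norm_nonneg _)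
    calc _ ≤ ‖T‖ * ‖w s‖ * ‖u‖ := mul_le_mul_of_nonneg_right h1 (norm_nonneg _)
      _ = _ := by ring
  have := hw0 t t.2
  simp only [w, hH, hY, sub_eq_zero] at this
  exact this

/-- **Frobenius theorem, graph form.** If the total differential equation `∂y = A(u, y)` satisfies
the integrability condition near `0` and `A 0 = 0`, then its solutions `(u, z) ↦ (u, y(u, z))`,
parametrised by their values `z` at `u = 0`, form a local diffeomorphism carrying `K × 0` to the
graphs of `A`. -/
theorem exists_straightening_of_graph [CompleteSpace K] [CompleteSpace L]
    (hA : ContDiff ℝ ∞ A) (hA0 : A 0 = 0)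
    (hinv : ∀ᶠ x in 𝓝 (0 : K × L), ∀ a b : K,
      fderiv ℝ A x (a, A x a) b = fderiv ℝ A x (b, A x b) a) :
    ∃ φ : OpenPartialHomeomorph (K × L) (K × L), 0 ∈ φ.source ∧ φ 0 = 0 ∧
      ContDiffOn ℝ ∞ φ φ.source ∧ ContDiffOn ℝ ∞ φ.symm φ.target ∧
      ∀ x ∈ φ.source, ∀ v : K, fderiv ℝ φ x (v, 0) = (v, A (φ x) v) := by
  obtain ⟨r, hr, hrinv⟩ := Metric.eventually_nhds_iff_ball.1 hinv
  have hΨ := contDiff_integralEquation hA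
  obtain ⟨ψ, hψ, hψ0, hψr, -, hψs⟩ := exists_smooth_openPartialHomeomorph
    (Metric.isOpen_ball (x := (0 : K × C(I, L))) (ε := r)) hΨ.contDiffOn
    (Metric.mem_ball_self hr) (by
      rw [fderiv_integralEquation_zero hA hA0]
      exact ⟨ContinuousLinearEquiv.refl ℝ _, rfl⟩)
  have hΨ0 : integralEquation hA 0 = 0 := by
    have : velocity hA 0 = 0 := by ext t; simp [velocity_apply]
    simp [integralEquation, this]
  -- `S (u, z)` is the solution along the segment from `0` to `u` with initial value `z`.
  let c : K × L →L[ℝ] K × C(I, L) :=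
    (ContinuousLinearMap.id ℝ K).prodMap (constCLM I L)
  let W : Set (K × L) := c ⁻¹' ψ.target
  have hW : IsOpen W := ψ.open_target.preimage c.continuous
  let S : K × L → K × C(I, L) := fun x ↦ ψ.symm (c x)
  have hS : ContDiffOn ℝ ∞ S W := hψs.comp c.contDiff.contDiffOn fun x hx ↦ hx
  have hΨS : ∀ x ∈ W, integralEquation hA (S x) = c x := fun x hx ↦ by
    rw [← hψ]; exact ψ.right_inv hx
  have hSd : ∀ x ∈ W, DifferentiableAt ℝ S x := fun x hx ↦
    (hS.contDiffAt (hW.mem_nhds hx)).differentiableAt (by simp)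
  have hS1 : ∀ x ∈ W, (S x).1 = x.1 := fun x hx ↦ congrArg Prod.fst (hΨS x hx)
  have hΨSd : ∀ x ∈ W, ∀ q, fderiv ℝ (integralEquation hA) (S x) (fderiv ℝ S x q) = c q := by
    intro x hx q
    have h1 := ((hΨ.differentiable (by simp) (S x)).hasFDerivAt.comp x (hSd x hx).hasFDerivAt)
    have h2 : HasFDerivAt (integralEquation hA ∘ S) c x :=
      c.hasFDerivAt.congr_of_eventuallyEq (by
        filter_upwards [hW.mem_nhds hx] with y hy using hΨS y hy)
    exact congrArg (fun T : K × L →L[ℝ] K × C(I, L) ↦ T q) (h1.unique h2)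
  have h0W : (0 : K × L) ∈ W := by
    have := ψ.map_source hψ0
    rw [hψ, hΨ0] at this
    simpa [W] using this
  have hS0 : S 0 = 0 := by
    have := ψ.left_inv hψ0
    rw [hψ, hΨ0] at this
    simpa [S] using this
  let ev : K × C(I, L) →L[ℝ] K × L :=
    (ContinuousLinearMap.id ℝ K).prodMap (ContinuousMap.evalCLM ℝ (1 : I))
  let f : K × L → K × L := fun x ↦ ev (S x)
  have hf : ContDiffOn ℝ ∞ f W := ev.contDiff.comp_contDiffOn hS
  have hfd : ∀ x ∈ W, ∀ q, fderiv ℝ f x q = ev (fderiv ℝ S x q) := by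
    intro x hx q
    have : HasFDerivAt f (ev.comp (fderiv ℝ S x)) x := ev.hasFDerivAt.comp x (hSd x hx).hasFDerivAt
    rw [this.fderiv]; rfl
  have hf0 : fderiv ℝ f 0 = ContinuousLinearMap.id ℝ (K × L) := by
    refine ContinuousLinearMap.ext fun q ↦ ?_
    have := hΨSd 0 h0W q
    rw [hS0, fderiv_integralEquation_zero hA hA0] at this
    rw [hfd 0 h0W, show fderiv ℝ S 0 q = c q from this]
    rfl
  obtain ⟨φ, hφ, hφ0, hφW, -, hφs⟩ := exists_smooth_openPartialHomeomorph hW hf h0W (by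
    rw [hf0]; exact ⟨ContinuousLinearEquiv.refl ℝ _, rfl⟩)
  refine ⟨φ, hφ0, ?_, ?_, hφs, ?_⟩
  · rw [hφ]; simp [f, hS0]
  · rw [hφ]; exact hf.mono hφW
  rw [hφ]
  intro x hx v
  have hxW := hφW hx
  have hd := hΨSd x hxW (v, 0)
  rw [fderiv_integralEquation] at hd
  have hd1 : (fderiv ℝ S x (v, 0)).1 = v := congrArg Prod.fst hd
  have hd2 := congrArg Prod.snd hd
  simp only [c, ContinuousLinearMap.coe_prodMap', Prod.map_snd, map_zero, sub_eq_zero] at hd2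
  have hSx : S x = (x.1, (S x).2) := Prod.ext (hS1 x hxW) rfl
  have hdx : fderiv ℝ S x (v, 0) = (v, (fderiv ℝ S x (v, 0)).2) := Prod.ext hd1 rfl
  have hSr : ‖S x‖ < r := by
    have := hψr (ψ.map_target hxW)
    simpa using this
  have key := eq_smul_of_linearised hA (u := x.1) (v := v) (z := x.2) (y := (S x).2)
    (η := (fderiv ℝ S x (v, 0)).2) ?_ ?_ ?_ 1
  · rw [hfd x hxW]
    refine Prod.ext hd1 ?_
    refine key.trans ?_
    simp only [rayCLM_apply, Icc.coe_one, one_smul]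
    have : f x = (x.1, (S x).2 1) := Prod.ext (hS1 x hxW) rfl
    rw [this]
  · intro t
    have h := congrArg (fun p : K × C(I, L) ↦ p.2 t) (hΨS x hxW)
    have h' : (S x).2 t - primitiveCLM L (velocity hA (S x)) t = x.2 := h
    rw [← hSx, ← h', sub_add_cancel]
  · rw [← hSx, ← hdx]
    exact hd2
  · intro t a b
    rw [← hSx]
    exact hrinv _ (by simpa using (norm_rayCLM_apply_le (S x) t).trans_lt hSr) a b

end TotalDifferentialEquation

/-! ### Frobenius theorem for the kernel of a smooth coframe -/

section Coframe

universe u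

lemma exists_contDiff_eventuallyEq {E F : Type*} [NormedAddCommGroup E] [NormedSpace ℝ E]
    [FiniteDimensional ℝ E] [NormedAddCommGroup F] [NormedSpace ℝ F] {f : E → F} {U : Set E}
    (hU : IsOpen U) (hf : ContDiffOn ℝ ∞ f U) {x : E} (hx : x ∈ U) :
    ∃ g : E → F, ContDiff ℝ ∞ g ∧ g =ᶠ[𝓝 x] f := by
  obtain ⟨r, hr, hrU⟩ := Metric.nhds_basis_closedBall.mem_iff.1 (hU.mem_nhds hx)
  let c : ContDiffBump x := ⟨r / 2, r, half_pos hr, half_lt_self hr⟩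
  refine ⟨fun y ↦ c y • f y, contDiff_iff_contDiffAt.2 fun y ↦ ?_, ?_⟩
  · by_cases hy : y ∈ U
    · exact c.contDiff.contDiffAt.smul (hf.contDiffAt (hU.mem_nhds hy))
    · have hy' : y ∉ tsupport c := fun h ↦ hy (hrU (by rwa [c.tsupport_eq] at h))
      refine (contDiffAt_const (c := (0 : F))).congr_of_eventuallyEq ?_
      filter_upwards [notMem_tsupport_iff_eventuallyEq.1 hy'] with z hz
      simp [hz]
  · filter_upwards [c.eventuallyEq_one] with y hy
    simp [hy]

/-- **Frobenius theorem.** Let `T x` be a smooth family of linear maps, surjective at `x₀`. If the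
Lie bracket of two vector fields with values in `ker T x` again has values in `ker T x`, then a
local diffeomorphism at `x₀` carries `ker T x` to a constant subspace. In a splitting
`E = K ⊕ L` with `K = ker T x₀`, the kernels are the graphs of maps `A x : K → L`, and the bracket
condition for the fields `(a, A x a)` is the integrability condition of `∂y = A(·, y)`. -/
theorem exists_straightening_of_ker {E W : Type u} [NormedAddCommGroup E] [NormedSpace ℝ E]
    [FiniteDimensional ℝ E] [NormedAddCommGroup W] [NormedSpace ℝ W] [FiniteDimensional ℝ W]
    {T : E → E →L[ℝ] W} {U : Set E} (hU : IsOpen U) (hT : ContDiffOn ℝ ∞ T U) {x₀ : E}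
    (hx₀ : x₀ ∈ U) (hsurj : Function.Surjective (T x₀))
    (hinv : ∀ V ⊆ U, IsOpen V → ∀ X Y : E → E, ContDiff ℝ ∞ X → ContDiff ℝ ∞ Y →
      (∀ x ∈ V, T x (X x) = 0) → (∀ x ∈ V, T x (Y x) = 0) →
      ∀ x ∈ V, T x (VectorField.lieBracket ℝ X Y x) = 0) :
    ∃ φ : OpenPartialHomeomorph E E, x₀ ∈ φ.source ∧ φ.source ⊆ U ∧
      ContDiffOn ℝ ∞ φ φ.source ∧ ContDiffOn ℝ ∞ φ.symm φ.target ∧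
      ∃ K : Submodule ℝ E, ∀ x ∈ φ.source, ∀ v, T x v = 0 ↔ fderiv ℝ φ x v ∈ K := by
  let K : Submodule ℝ E := LinearMap.ker (T x₀).toLinearMap
  obtain ⟨L, hKL⟩ := Submodule.exists_isCompl K
  let e : (K × L) ≃L[ℝ] E := (Submodule.prodEquivOfIsCompl K L hKL).toContinuousLinearEquiv
  have he : ∀ p : K × L, e p = p.1 + p.2 := fun p ↦ rfl
  let B : E → L →L[ℝ] W := fun x ↦ (T x).comp L.subtypeL
  have hB : ContDiffOn ℝ ∞ B U := hT.clm_comp contDiffOn_const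
  have hB0 : B x₀ ∈ range ((↑) : (L ≃L[ℝ] W) → L →L[ℝ] W) := by
    have hinj : Function.Injective (B x₀) := by
      refine (injective_iff_map_eq_zero _).2 fun l hl ↦ ?_
      have : (l : E) ∈ K ⊓ L := ⟨hl, l.2⟩
      rw [hKL.inf_eq_bot] at this
      exact Subtype.ext (by simpa using this)
    have hsur : Function.Surjective (B x₀) := by
      intro w
      obtain ⟨v, rfl⟩ := hsurj w
      obtain ⟨p, rfl⟩ := e.surjective v
      refine ⟨p.2, ?_⟩
      have : T x₀ p.1 = 0 := p.1.2
      rw [he, map_add, this, zero_add]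
      rfl
    exact ⟨(LinearEquiv.ofBijective (B x₀).toLinearMap ⟨hinj, hsur⟩).toContinuousLinearEquiv, rfl⟩
  let U₁ : Set E := U ∩ B ⁻¹' range ((↑) : (L ≃L[ℝ] W) → L →L[ℝ] W)
  have hU₁ : IsOpen U₁ := hB.continuousOn.isOpen_inter_preimage hU ContinuousLinearEquiv.isOpen
  -- The chart `τ` splits `E` around `x₀`; its inverse is `σ`.
  let τ : E ≃ₜ K × L := (Homeomorph.subRight x₀).trans e.symm.toHomeomorph
  have hτ : ∀ x, τ x = e.symm (x - x₀) := fun x ↦ rfl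
  have hτs : ContDiff ℝ ∞ τ := e.symm.contDiff.comp (contDiff_id.sub contDiff_const)
  have hτd : ∀ x, HasFDerivAt τ (e.symm : E →L[ℝ] K × L) x := fun x ↦ by
    exact (e.symm : E →L[ℝ] K × L).hasFDerivAt.comp x ((hasFDerivAt_id x).sub_const x₀)
  let σ : K × L → E := fun p ↦ e p + x₀
  have hσ : ContDiff ℝ ∞ σ := e.contDiff.add contDiff_const
  have hστ : ∀ x, σ (τ x) = x := fun x ↦ by simp [σ, hτ]
  have hτσ : ∀ p, τ (σ p) = p := fun x ↦ by simp [σ, hτ]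
  have hσ0 : σ 0 = x₀ := by simp [σ]
  let A₀ : K × L → K →L[ℝ] L := fun p ↦
    -((B (σ p)).inverse.comp ((T (σ p)).comp K.subtypeL))
  have hU₂ : IsOpen (σ ⁻¹' U₁) := hU₁.preimage hσ.continuous
  have hA₀ : ContDiffOn ℝ ∞ A₀ (σ ⁻¹' U₁) := by
    refine ContDiffOn.neg (ContDiffOn.clm_comp ?_ (ContDiffOn.clm_comp ?_ contDiffOn_const))
    · rintro p ⟨hp, g, hg⟩
      have h1 : ContDiffAt ℝ ∞ ContinuousLinearMap.inverse (B (σ p)) := by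
        rw [← hg]; exact contDiffAt_map_inverse g
      exact (h1.comp p ((hB.contDiffAt (hU.mem_nhds hp)).comp p hσ.contDiffAt)).contDiffWithinAt
    · exact hT.comp hσ.contDiffOn fun p hp ↦ hp.1
  have hker : ∀ p ∈ σ ⁻¹' U₁, ∀ a : K, ∀ b : L, T (σ p) (e (a, b)) = 0 ↔ b = A₀ p a := by
    rintro p ⟨-, g, hg⟩ a b
    have h1 : T (σ p) (e (a, b)) = T (σ p) a + g b := by
      rw [he, map_add]
      exact congrArg _ (congrArg (fun S : L →L[ℝ] W ↦ S b) hg).symm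
    have h2 : A₀ p a = -(g.symm (T (σ p) a)) := by
      have : (B (σ p)).inverse = (g.symm : W →L[ℝ] L) := by
        rw [← hg]; exact ContinuousLinearMap.inverse_equiv g
      simp [A₀, this]
    rw [h1, h2, ← map_neg, ContinuousLinearEquiv.eq_symm_apply, eq_neg_iff_add_eq_zero, add_comm]
  have h0U₁ : (0 : K × L) ∈ σ ⁻¹' U₁ := by
    rw [mem_preimage, hσ0]; exact ⟨hx₀, hB0⟩
  obtain ⟨A, hA, hAA₀⟩ := exists_contDiff_eventuallyEq hU₂ hA₀ h0U₁
  obtain ⟨U₃, hU₃, hU₃o, h0U₃⟩ := mem_nhds_iff.1 (inter_mem hAA₀ (hU₂.mem_nhds h0U₁))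
  have hker' : ∀ p ∈ U₃, ∀ a : K, ∀ b : L, T (σ p) (e (a, b)) = 0 ↔ b = A p a := by
    intro p hp a b
    rw [hker p (hU₃ hp).2, show A p = A₀ p from (hU₃ hp).1]
  have hA0 : A 0 = 0 := by
    ext1 a
    refine ((hker' 0 h0U₃ a 0).1 ?_).symm
    rw [hσ0, he]
    simp
  -- The vector fields `x ↦ (a, A x a)` span the kernels.
  let X : K → E → E := fun a x ↦ e (a, A (τ x) a)
  have hX : ∀ a, ContDiff ℝ ∞ (X a) := fun a ↦
    e.contDiff.comp (contDiff_const.prodMk ((hA.comp hτs).clm_apply contDiff_const))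
  have hXd : ∀ a x w, fderiv ℝ (X a) x w = e (0, fderiv ℝ A (τ x) (e.symm w) a) := by
    intro a x w
    have h1 : HasFDerivAt (fun x ↦ A (τ x)) _ x :=
      ((hA.differentiable (by simp) (τ x)).hasFDerivAt).comp x (hτd x)
    have h2 : HasFDerivAt (X a) _ x := (e : K × L →L[ℝ] E).hasFDerivAt.comp x
      ((hasFDerivAt_const a x).prodMk (h1.clm_apply (hasFDerivAt_const a x)))
    rw [h2.fderiv]
    simp
  have hinvA : ∀ᶠ p in 𝓝 (0 : K × L), ∀ a b : K,
      fderiv ℝ A p (a, A p a) b = fderiv ℝ A p (b, A p b) a := by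
    filter_upwards [hU₃o.mem_nhds h0U₃] with p hp a b
    have hmem : ∀ a, ∀ x ∈ τ ⁻¹' U₃, T x (X a x) = 0 := fun a x hx ↦ by
      have := (hker' (τ x) hx a _).2 rfl
      rwa [hστ] at this
    have h := hinv (τ ⁻¹' U₃) (fun x hx ↦ by have := (hU₃ hx).2.1; rwa [hστ] at this)
      (hU₃o.preimage τ.continuous) (X a) (X b) (hX a) (hX b) (hmem a) (hmem b) (σ p)
      (by rw [mem_preimage, hτσ]; exact hp)
    rw [VectorField.lieBracket, hXd, hXd, ← map_sub, hτσ] at h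
    have h' := (hker' p hp _ _).1 h
    simpa [X, hτσ, sub_eq_zero] using h'
  obtain ⟨φ, hφ0, hφ00, hφ, hφs, hφd⟩ := exists_straightening_of_graph hA hA0 hinvA
  refine ⟨(τ.toOpenPartialHomeomorph.trans (φ.symm.restrOpen U₃ hU₃o)).trans
    e.toHomeomorph.toOpenPartialHomeomorph, ?_, ?_, ?_, ?_, K, ?_⟩
  · have : τ x₀ = 0 := by simp [hτ]
    have h1 : (0 : K × L) ∈ φ.target := by rw [← hφ00]; exact φ.map_source hφ0
    simp [this, h1, h0U₃]
  · intro x hx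
    have hx' : τ x ∈ U₃ := by simp at hx; exact hx.2
    have := (hU₃ hx').2.1
    rwa [hστ] at this
  · refine e.contDiff.comp_contDiffOn (hφs.comp hτs.contDiffOn fun x hx ↦ ?_)
    simp at hx; exact hx.1
  · refine hσ.comp_contDiffOn (hφ.comp e.symm.contDiff.contDiffOn fun x hx ↦ ?_)
    simp at hx; exact hx.1
  · intro x hx v
    have hxφ : τ x ∈ φ.target := by simp at hx; exact hx.1
    have hxU : τ x ∈ U₃ := by simp at hx; exact hx.2
    set q := φ.symm (τ x) with hq
    have hqs : q ∈ φ.source := φ.map_target hxφ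
    have hφq : φ q = τ x := φ.right_inv hxφ
    have d1 : HasFDerivAt φ (fderiv ℝ φ q) q :=
      ((hφ.contDiffAt (φ.open_source.mem_nhds hqs)).differentiableAt (by simp)).hasFDerivAt
    have d2 : HasFDerivAt φ.symm (fderiv ℝ φ.symm (τ x)) (τ x) :=
      ((hφs.contDiffAt (φ.open_target.mem_nhds hxφ)).differentiableAt (by simp)).hasFDerivAt
    have i1 : ∀ r, fderiv ℝ φ.symm (τ x) (fderiv ℝ φ q r) = r := by
      have h1 := HasFDerivAt.comp q (by rw [hφq]; exact d2) d1
      have h2 : HasFDerivAt (φ.symm ∘ φ) (ContinuousLinearMap.id ℝ _) q :=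
        (hasFDerivAt_id q).congr_of_eventuallyEq (by
          filter_upwards [φ.open_source.mem_nhds hqs] with y hy using φ.left_inv hy)
      exact fun r ↦ congrArg (fun S : K × L →L[ℝ] K × L ↦ S r) (h1.unique h2)
    have i2 : ∀ r, fderiv ℝ φ q (fderiv ℝ φ.symm (τ x) r) = r := by
      have h1 := HasFDerivAt.comp (τ x) d1 d2
      have h2 : HasFDerivAt (φ ∘ φ.symm) (ContinuousLinearMap.id ℝ _) (τ x) :=
        (hasFDerivAt_id _).congr_of_eventuallyEq (by
          filter_upwards [φ.open_target.mem_nhds hxφ] with y hy using φ.right_inv hy)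
      exact fun r ↦ congrArg (fun S : K × L →L[ℝ] K × L ↦ S r) (h1.unique h2)
    have hΦ : HasFDerivAt (fun x ↦ e (φ.symm (τ x)))
        ((e : K × L →L[ℝ] E).comp ((fderiv ℝ φ.symm (τ x)).comp (e.symm : E →L[ℝ] K × L))) x :=
      (e : K × L →L[ℝ] E).hasFDerivAt.comp x (d2.comp x (hτd x))
    obtain ⟨⟨a, b⟩, rfl⟩ := e.surjective v
    have hfd : fderiv ℝ ((τ.toOpenPartialHomeomorph.trans (φ.symm.restrOpen U₃ hU₃o)).trans
        e.toHomeomorph.toOpenPartialHomeomorph) x (e (a, b)) =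
        e (fderiv ℝ φ.symm (τ x) (a, b)) := by
      have := congrArg (fun S : E →L[ℝ] E ↦ S (e (a, b))) hΦ.fderiv
      refine Eq.trans this ?_
      simp
    have heK : ∀ r : K × L, e r ∈ K ↔ r.2 = 0 := by
      intro r
      rw [he]
      constructor
      · intro h
        have : (r.2 : E) ∈ K ⊓ L := ⟨(Submodule.add_mem_iff_right K r.1.2).1 h, r.2.2⟩
        rw [hKL.inf_eq_bot] at this
        exact Subtype.ext (by simpa using this)
      · intro h
        rw [h]; simp
    rw [hfd, heK]
    have := hker' (τ x) hxU a b
    rw [hστ] at this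
    rw [this, ← hφq]
    constructor
    · intro h
      have h1 := i1 (a, 0)
      rw [hφd q hqs, ← h] at h1
      rw [hφq, h1]
    · intro h
      have h1 := i2 (a, b)
      rw [hφq] at h
      rw [show fderiv ℝ φ.symm (τ x) (a, b) = ((fderiv ℝ φ.symm (τ x) (a, b)).1, 0) from
        Prod.ext rfl h, hφd q hqs] at h1
      have h2 : (fderiv ℝ φ.symm (τ x) (a, b)).1 = a := congrArg Prod.fst h1
      have h3 : A (φ q) (fderiv ℝ φ.symm (τ x) (a, b)).1 = b := congrArg Prod.snd h1
      rw [← h3, h2]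

end Coframe

/-! ### Vector fields in charts -/

section Manifold

lemma mem_contDiffGroupoid_of_contDiffOn {E : Type*} [NormedAddCommGroup E] [NormedSpace ℝ E]
    {φ : OpenPartialHomeomorph E E} (h : ContDiffOn ℝ ∞ φ φ.source)
    (h' : ContDiffOn ℝ ∞ φ.symm φ.target) : φ ∈ contDiffGroupoid ∞ 𝓘(ℝ, E) := by
  refine mem_groupoid_of_pregroupoid.2 ⟨?_, ?_⟩
  · simpa [contDiffPregroupoid] using h
  · simpa [contDiffPregroupoid] using h'

variable {E : Type*} [NormedAddCommGroup E] [NormedSpace ℝ E]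
  {N : Type*} [TopologicalSpace N] [ChartedSpace E N] [IsManifold 𝓘(ℝ, E) ∞ N]

lemma trans_mem_maximalAtlas {φ : OpenPartialHomeomorph E E} (x : N)
    (h : ContDiffOn ℝ ∞ φ φ.source) (h' : ContDiffOn ℝ ∞ φ.symm φ.target) :
    (chartAt E x).trans φ ∈ IsManifold.maximalAtlas 𝓘(ℝ, E) ∞ N := by
  have hφ := mem_contDiffGroupoid_of_contDiffOn h h'
  rw [IsManifold.mem_maximalAtlas_iff]
  intro e he
  constructor
  · rw [OpenPartialHomeomorph.trans_symm_eq_symm_trans_symm, OpenPartialHomeomorph.trans_assoc]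
    exact (contDiffGroupoid ∞ 𝓘(ℝ, E)).trans ((contDiffGroupoid ∞ 𝓘(ℝ, E)).symm hφ)
      (HasGroupoid.compatible (chart_mem_atlas E x) he)
  · rw [← OpenPartialHomeomorph.trans_assoc]
    exact (contDiffGroupoid ∞ 𝓘(ℝ, E)).trans
      (HasGroupoid.compatible he (chart_mem_atlas E x)) hφ

lemma contMDiffAt_chartAt {x₀ x : N} (hx : x ∈ (chartAt E x₀).source) :
    ContMDiffAt 𝓘(ℝ, E) 𝓘(ℝ, E) ∞ (chartAt E x₀) x :=
  (contMDiffOn_chart (x := x₀)).contMDiffAt ((chartAt E x₀).open_source.mem_nhds hx)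

lemma two_le_infty : (2 : ℕ∞ω) ≤ ∞ :=
  WithTop.coe_le_coe.2 (le_top : (2 : ℕ∞) ≤ ⊤)

lemma isInvertible_mfderiv_chartAt {x₀ x : N} (hx : x ∈ (chartAt E x₀).source) :
    (mfderiv 𝓘(ℝ, E) 𝓘(ℝ, E) (chartAt E x₀) x).IsInvertible := by
  have : IsManifold 𝓘(ℝ, E) 1 N := IsManifold.of_le (n := ∞) (by simp)
  exact ⟨(mdifferentiable_chart (I := 𝓘(ℝ, E)) x₀).mfderiv hx, rfl⟩

/-- The derivative of the chart at `x₀`, with values in the model space. -/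
def chartDeriv (x₀ x : N) : TangentSpace 𝓘(ℝ, E) x →L[ℝ] E :=
  mfderiv 𝓘(ℝ, E) 𝓘(ℝ, E) (chartAt E x₀) x

/-- The vector field on the domain of the chart at `x₀` which reads `X` in this chart. -/
def chartField (x₀ : N) (X : E → E) (x : N) : TangentSpace 𝓘(ℝ, E) x :=
  VectorField.mpullback 𝓘(ℝ, E) 𝓘(ℝ, E) (chartAt E x₀) X x

lemma chartDeriv_chartField {x₀ x : N} (hx : x ∈ (chartAt E x₀).source) (X : E → E) :
    chartDeriv x₀ x (chartField x₀ X x) = X (chartAt E x₀ x) :=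
  (isInvertible_mfderiv_chartAt hx).self_apply_inverse _

lemma chartField_chartDeriv {x₀ x : N} (hx : x ∈ (chartAt E x₀).source)
    (v : TangentSpace 𝓘(ℝ, E) x) :
    chartField x₀ (fun _ ↦ chartDeriv x₀ x v) x = v :=
  (isInvertible_mfderiv_chartAt hx).inverse_apply_self _

lemma contMDiffAt_chartField [CompleteSpace E] {x₀ x : N}
    (hx : x ∈ (chartAt E x₀).source) {X : E → E} (hX : ContDiff ℝ ∞ X) :
    CMDiffAt ∞ (T% (chartField x₀ X)) x := by
  refine ContMDiffAt.mpullback_vectorField_preimage (n := ∞) (V := X) ?_ (contMDiffAt_chartAt hx)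
    (isInvertible_mfderiv_chartAt hx) (by simp)
  exact contMDiff_vectorSpace_iff_contDiff.2 hX _

lemma mlieBracket_eq_lieBracket {E : Type*} [NormedAddCommGroup E] [NormedSpace ℝ E]
    {V W : ∀ x : E, TangentSpace 𝓘(ℝ, E) x} :
    VectorField.mlieBracket 𝓘(ℝ, E) V W = VectorField.lieBracket ℝ V W := by
  rw [← VectorField.mlieBracketWithin_univ, VectorField.mlieBracketWithin_eq_lieBracketWithin]
  exact VectorField.lieBracketWithin_univ

lemma mlieBracket_chartField [CompleteSpace E] {x₀ x : N}
    (hx : x ∈ (chartAt E x₀).source) {X Y : E → E} (hX : ContDiffAt ℝ ∞ X (chartAt E x₀ x))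
    (hY : ContDiffAt ℝ ∞ Y (chartAt E x₀ x)) :
    VectorField.mlieBracket 𝓘(ℝ, E) (chartField x₀ X) (chartField x₀ Y) x =
      chartField x₀ (VectorField.lieBracket ℝ X Y) x := by
  have : IsManifold 𝓘(ℝ, E) (minSmoothness ℝ 2) N :=
    IsManifold.of_le (n := ∞) (by simpa using two_le_infty)
  have h := VectorField.mpullback_mlieBracket (I := 𝓘(ℝ, E)) (I' := 𝓘(ℝ, E)) (n := ∞) (V := X)
    (W := Y) ((contMDiffAt_vectorSpace_iff_contDiffAt.2 hX).mdifferentiableAt (by simp))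
    ((contMDiffAt_vectorSpace_iff_contDiffAt.2 hY).mdifferentiableAt (by simp))
    (contMDiffAt_chartAt hx) (by simpa using two_le_infty)
  have h' : VectorField.mlieBracket 𝓘(ℝ, E) X Y = VectorField.lieBracket ℝ X Y :=
    mlieBracket_eq_lieBracket
  rw [h'] at h
  exact h.symm

lemma contMDiffAt_chartAt_symm {x₀ : N} {z : E} (hz : z ∈ (chartAt E x₀).target) :
    ContMDiffAt 𝓘(ℝ, E) 𝓘(ℝ, E) ∞ (chartAt E x₀).symm z :=
  (contMDiffOn_chart_symm (x := x₀)).contMDiffAt ((chartAt E x₀).open_target.mem_nhds hz)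

lemma mfderiv_chartAt_symm {x₀ : N} {z : E} (hz : z ∈ (chartAt E x₀).target) (a : E) :
    mfderiv 𝓘(ℝ, E) 𝓘(ℝ, E) (chartAt E x₀).symm z a =
      chartField x₀ (fun _ ↦ a) ((chartAt E x₀).symm z) := by
  have : IsManifold 𝓘(ℝ, E) 1 N := IsManifold.of_le (n := ∞) (by simp)
  have h := (mdifferentiable_chart (I := 𝓘(ℝ, E)) x₀).comp_symm_deriv hz
  have h' := congrArg (fun S : E →L[ℝ] E ↦ S a) h
  have := chartField_chartDeriv ((chartAt E x₀).map_target hz)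
    (mfderiv 𝓘(ℝ, E) 𝓘(ℝ, E) (chartAt E x₀).symm z a)
  rw [← this]
  congr 1
  funext _
  exact h'

lemma contMDiffAt_chartField_const [CompleteSpace E] {x₀ x : N}
    (hx : x ∈ (chartAt E x₀).source) (a : E) :
    CMDiffAt ∞ (T% (chartField x₀ (fun _ : E ↦ a))) x :=
  contMDiffAt_chartField hx contDiff_const

lemma mlieBracket_chartField_const [CompleteSpace E] {x₀ x : N}
    (hx : x ∈ (chartAt E x₀).source) (a b : E) :
    VectorField.mlieBracket 𝓘(ℝ, E) (chartField x₀ (fun _ ↦ a)) (chartField x₀ (fun _ ↦ b)) x =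
      0 := by
  rw [mlieBracket_chartField hx contDiffAt_const contDiffAt_const]
  have : VectorField.lieBracket ℝ (fun _ : E ↦ a) (fun _ ↦ b) = fun _ ↦ 0 := by
    funext y; simp [VectorField.lieBracket]
  rw [this]
  exact map_zero _

/-- The expression of the vector field `X` in the chart at `x₀`. -/
def readField (x₀ : N) (X : ∀ x : N, TangentSpace 𝓘(ℝ, E) x) (y : E) : E :=
  chartDeriv x₀ ((chartAt E x₀).symm y) (X ((chartAt E x₀).symm y))

lemma readField_chartAt {x₀ x : N} (hx : x ∈ (chartAt E x₀).source)
    (X : ∀ x : N, TangentSpace 𝓘(ℝ, E) x) :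
    readField x₀ X (chartAt E x₀ x) = chartDeriv x₀ x (X x) :=
  congrArg (fun z ↦ (chartDeriv x₀ z (X z) : E)) ((chartAt E x₀).left_inv hx)

lemma chartField_readField {x₀ x : N} (hx : x ∈ (chartAt E x₀).source)
    (X : ∀ x : N, TangentSpace 𝓘(ℝ, E) x) : chartField x₀ (readField x₀ X) x = X x := by
  refine Eq.trans ?_ (chartField_chartDeriv hx (X x))
  exact congrArg (fun a ↦ (mfderiv 𝓘(ℝ, E) 𝓘(ℝ, E) (chartAt E x₀) x).inverse a)
    (readField_chartAt hx X)

lemma isInvertible_mfderiv_chartAt_symm {x₀ : N} {z : E} (hz : z ∈ (chartAt E x₀).target) :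
    (mfderiv 𝓘(ℝ, E) 𝓘(ℝ, E) (chartAt E x₀).symm z).IsInvertible := by
  have : IsManifold 𝓘(ℝ, E) 1 N := IsManifold.of_le (n := ∞) (by simp)
  exact ⟨(mdifferentiable_chart (I := 𝓘(ℝ, E)) x₀).symm.mfderiv hz, rfl⟩

lemma inverse_mfderiv_chartAt_symm {x₀ : N} {z : E} (hz : z ∈ (chartAt E x₀).target)
    (v : TangentSpace 𝓘(ℝ, E) ((chartAt E x₀).symm z)) :
    (mfderiv 𝓘(ℝ, E) 𝓘(ℝ, E) (chartAt E x₀).symm z).inverse v =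
      chartDeriv x₀ ((chartAt E x₀).symm z) v := by
  refine Eq.trans (congrArg _ ?_) ((isInvertible_mfderiv_chartAt_symm hz).inverse_apply_self _)
  exact ((mfderiv_chartAt_symm hz _).trans
    (chartField_chartDeriv ((chartAt E x₀).map_target hz) v)).symm

lemma contDiffAt_readField [CompleteSpace E] {x₀ : N} {z : E} (hz : z ∈ (chartAt E x₀).target)
    {X : ∀ x : N, TangentSpace 𝓘(ℝ, E) x} (hX : CMDiffAt ∞ (T% X) ((chartAt E x₀).symm z)) :
    ContDiffAt ℝ ∞ (readField x₀ X) z := by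
  have h := ContMDiffWithinAt.mpullback_vectorField_preimage (n := ∞)
    (contMDiffWithinAt_univ.2 hX) (contMDiffAt_chartAt_symm hz)
    (isInvertible_mfderiv_chartAt_symm hz) (by simp)
  rw [preimage_univ, contMDiffWithinAt_univ] at h
  refine (contMDiffAt_vectorSpace_iff_contDiffAt.1 h).congr_of_eventuallyEq ?_
  filter_upwards [(chartAt E x₀).open_target.mem_nhds hz] with z' hz'
  exact (inverse_mfderiv_chartAt_symm hz' _).symm

/-! ### Frobenius theorem on manifolds -/

/-- **Frobenius theorem** for an involutive distribution which near every point is, in the preferred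
chart, the kernel of a smooth family `T` of surjective linear maps. -/
theorem isIntegrable_of_isInvolutive {n : ℕ} {N : Type*} [TopologicalSpace N]
    [ChartedSpace (EuclideanSpace ℝ (Fin n)) N] [IsManifold (𝓡 n) ∞ N]
    {D : ∀ x : N, Submodule ℝ (TangentSpace (𝓡 n) x)} (hD : IsInvolutive (𝓡 n) D)
    (hT : ∀ x₀ : N, ∃ (k : ℕ) (U : Set (EuclideanSpace ℝ (Fin n)))
      (T : EuclideanSpace ℝ (Fin n) → EuclideanSpace ℝ (Fin n) →L[ℝ] (Fin k → ℝ)),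
      IsOpen U ∧ U ⊆ (chartAt (EuclideanSpace ℝ (Fin n)) x₀).target ∧
      chartAt (EuclideanSpace ℝ (Fin n)) x₀ x₀ ∈ U ∧ ContDiffOn ℝ ∞ T U ∧
      Function.Surjective (T (chartAt (EuclideanSpace ℝ (Fin n)) x₀ x₀)) ∧
      ∀ x ∈ (chartAt (EuclideanSpace ℝ (Fin n)) x₀).source,
        chartAt (EuclideanSpace ℝ (Fin n)) x₀ x ∈ U → ∀ v : TangentSpace (𝓡 n) x,
          v ∈ D x ↔ T (chartAt (EuclideanSpace ℝ (Fin n)) x₀ x)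
            (chartDeriv x₀ x v) = 0) :
    IsIntegrable D := by
  intro x₀
  obtain ⟨k, U, T, hU, hUt, hx₀, hTs, hsurj, hDT⟩ := hT x₀
  set c := chartAt (EuclideanSpace ℝ (Fin n)) x₀ with hc
  have hbr : ∀ V ⊆ U, IsOpen V → ∀ X Y : EuclideanSpace ℝ (Fin n) → EuclideanSpace ℝ (Fin n),
      ContDiff ℝ ∞ X → ContDiff ℝ ∞ Y →
      (∀ y ∈ V, T y (X y) = 0) → (∀ y ∈ V, T y (Y y) = 0) →
      ∀ y ∈ V, T y (VectorField.lieBracket ℝ X Y y) = 0 := by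
    intro V hVU hV X Y hX hY hXT hYT y hy
    have hmem : ∀ Z : EuclideanSpace ℝ (Fin n) → EuclideanSpace ℝ (Fin n),
        (∀ y ∈ V, T y (Z y) = 0) → ∀ x ∈ c.source ∩ c ⁻¹' V,
          chartField x₀ Z x ∈ D x := by
      intro Z hZ x hx
      rw [hDT x hx.1 (hVU hx.2), chartDeriv_chartField hx.1]
      exact hZ _ hx.2
    have hyt := hUt (hVU hy)
    have hys : c.symm y ∈ c.source := c.map_target hyt
    have hcy : c (c.symm y) = y := c.right_inv hyt
    have := hD (c.source ∩ c ⁻¹' V) _ _ (c.isOpen_inter_preimage hV)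
      (fun x hx ↦ (contMDiffAt_chartField hx.1 hX).contMDiffWithinAt)
      (fun x hx ↦ (contMDiffAt_chartField hx.1 hY).contMDiffWithinAt)
      (hmem X hXT) (hmem Y hYT) (c.symm y) ⟨hys, by rw [mem_preimage, hcy]; exact hy⟩
    rw [mlieBracket_chartField hys hX.contDiffAt hY.contDiffAt,
      hDT _ hys (by rw [hcy]; exact hVU hy),
      chartDeriv_chartField hys, hcy] at this
    exact this
  obtain ⟨φ, hφ0, hφU, hφ, hφs, K, hK⟩ := exists_straightening_of_ker hU hTs hx₀ hsurj hbr
  refine ⟨c.trans φ, trans_mem_maximalAtlas x₀ hφ hφs, ?_, K, ?_⟩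
  · rw [OpenPartialHomeomorph.trans_source]
    exact ⟨mem_chart_source _ x₀, hφ0⟩
  · intro x hx v
    rw [OpenPartialHomeomorph.trans_source] at hx
    rw [hDT x hx.1 (hφU hx.2), hK _ hx.2]
    have h1 : MDifferentiableAt (𝓡 n) (𝓡 n) c x :=
      (contMDiffAt_chartAt hx.1).mdifferentiableAt (by simp)
    have h2 : MDifferentiableAt (𝓡 n) (𝓡 n) φ (c x) :=
      ((hφ.contDiffAt (φ.open_source.mem_nhds hx.2)).differentiableAt (by simp)).mdifferentiableAt
    have h3 := mfderiv_comp x h2 h1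
    rw [OpenPartialHomeomorph.coe_trans, h3, mfderiv_eq_fderiv]
    exact Iff.rfl

end Manifold

/-! ### The kernel of the pullback of a closed two-form -/

/-- Let `Φ` be a two-form on `E`, closed at `f y`. If `X` and `Y` lie in the kernel of `f^*Φ` near
`y`, then so does their Lie bracket at `y`. Differentiating `(f^*Φ)(X, ·) = 0` and
`(f^*Φ)(Y, ·) = 0` expresses `(f^*Φ)([X, Y], u)` through the cyclic sum of `DΦ` and second
derivatives of `f`; the latter cancel by symmetry. -/
theorem apply_fderiv_lieBracket_eq_zero {E E' : Type*} [NormedAddCommGroup E] [NormedSpace ℝ E]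
    [NormedAddCommGroup E'] [NormedSpace ℝ E'] {Φ : E → E →L[ℝ] E →L[ℝ] ℝ} {f : E' → E} {y : E'}
    (hf : ContDiffAt ℝ 2 f y) (hΦ : DifferentiableAt ℝ Φ (f y))
    (hskew : ∀ a b, Φ (f y) a b = -Φ (f y) b a)
    (hclosed : ∀ a b c, fderiv ℝ Φ (f y) a b c - fderiv ℝ Φ (f y) b a c +
      fderiv ℝ Φ (f y) c a b = 0)
    {X Y : E' → E'} (hX : DifferentiableAt ℝ X y) (hY : DifferentiableAt ℝ Y y)
    (hXk : ∀ᶠ y' in 𝓝 y, ∀ u, Φ (f y') (fderiv ℝ f y' (X y')) (fderiv ℝ f y' u) = 0)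
    (hYk : ∀ᶠ y' in 𝓝 y, ∀ u, Φ (f y') (fderiv ℝ f y' (Y y')) (fderiv ℝ f y' u) = 0) (u : E') :
    Φ (f y) (fderiv ℝ f y (VectorField.lieBracket ℝ X Y y)) (fderiv ℝ f y u) = 0 := by
  have hfd : HasFDerivAt f (fderiv ℝ f y) y := (hf.differentiableAt (by simp)).hasFDerivAt
  have hfd2 : HasFDerivAt (fderiv ℝ f) (fderiv ℝ (fderiv ℝ f) y) y :=
    ((hf.fderiv_right (m := 1) (by norm_num)).differentiableAt (by simp)).hasFDerivAt
  have hsymm : ∀ v w, fderiv ℝ (fderiv ℝ f) y v w = fderiv ℝ (fderiv ℝ f) y w v := fun v w ↦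
    (hf.isSymmSndFDerivAt (by simp)) v w
  -- The derivative at `y` in the direction `w` of the identity `(f^*Φ)(Z, v) = 0`.
  have key : ∀ Z : E' → E', DifferentiableAt ℝ Z y →
      (∀ᶠ y' in 𝓝 y, ∀ u, Φ (f y') (fderiv ℝ f y' (Z y')) (fderiv ℝ f y' u) = 0) → ∀ w v,
      Φ (f y) (fderiv ℝ f y (Z y)) (fderiv ℝ (fderiv ℝ f) y w v) +
        (fderiv ℝ Φ (f y) (fderiv ℝ f y w) (fderiv ℝ f y (Z y)) (fderiv ℝ f y v) +
        (Φ (f y) (fderiv ℝ f y (fderiv ℝ Z y w)) (fderiv ℝ f y v) +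
          Φ (f y) (fderiv ℝ (fderiv ℝ f) y w (Z y)) (fderiv ℝ f y v))) = 0 := by
    intro Z hZ hZk w v
    have h1 := (hΦ.hasFDerivAt.comp y hfd).clm_apply (hfd2.clm_apply hZ.hasFDerivAt)
    have h2 := h1.clm_apply (hfd2.clm_apply (hasFDerivAt_const v y))
    have h3 := h2.unique ((hasFDerivAt_const (0 : ℝ) y).congr_of_eventuallyEq (by
      filter_upwards [hZk] with y' hy' using hy' v))
    have h4 := congrArg (fun S : E' →L[ℝ] ℝ ↦ S w) h3
    simpa [add_assoc, add_comm, add_left_comm] using h4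
  have e1 := key Y hY hYk (X y) u
  have e2 := key X hX hXk (Y y) u
  have e3 := key X hX hXk u (Y y)
  have e4 := hYk.self_of_nhds (fderiv ℝ X y u)
  have e5 := hclosed (fderiv ℝ f y (X y)) (fderiv ℝ f y (Y y)) (fderiv ℝ f y u)
  rw [hskew] at e4
  rw [hsymm (Y y) (X y)] at e2
  rw [hsymm u (Y y), hsymm u (X y), hskew (fderiv ℝ (fderiv ℝ f) y (X y) u)] at e3
  rw [VectorField.lieBracket, map_sub, map_sub, sub_apply]
  linarith

/-! ### The fundamental two-form of a parallel affinor is closed -/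

section FundamentalForm

variable {E : Type*} [NormedAddCommGroup E] [NormedSpace ℝ E]
  {M : Type*} [TopologicalSpace M] [ChartedSpace E M] [IsManifold 𝓘(ℝ, E) ∞ M]
  [Bundle.RiemannianBundle (fun x : M ↦ TangentSpace 𝓘(ℝ, E) x)]

variable {F : ∀ x : M, TangentSpace 𝓘(ℝ, E) x →L[ℝ] TangentSpace 𝓘(ℝ, E) x}

lemma inner_affinor_right (hgF : IsAffinorMetric F 1) {x : M} (v w : TangentSpace 𝓘(ℝ, E) x) :
    inner ℝ v (F x w) = -inner ℝ (F x v) w := by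
  have := hgF x v w
  linarith

lemma inner_affinor_skew (hgF : IsAffinorMetric F 1) {x : M} (v w : TangentSpace 𝓘(ℝ, E) x) :
    inner ℝ v (F x w) = -inner ℝ w (F x v) := by
  rw [inner_affinor_right hgF, real_inner_comm]

variable [FiniteDimensional ℝ E]

variable (F) in
/-- The two-form `(v, w) ↦ g(v, F w)` at the point with coordinates `z` in the chart at `p₀`. -/
def fundamentalForm (p₀ : M) (z : E) : E →L[ℝ] E →L[ℝ] ℝ :=
  (LinearMap.mk₂ ℝ (fun a b : E ↦ inner ℝ (chartField p₀ (fun _ ↦ a) ((chartAt E p₀).symm z))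
    (F _ (chartField p₀ (fun _ ↦ b) ((chartAt E p₀).symm z))))
    (fun a a' b ↦ by
      rw [← inner_add_left]; congr 1; exact map_add _ _ _)
    (fun c a b ↦ by
      rw [smul_eq_mul, ← real_inner_smul_left]; congr 1; exact map_smul _ _ _)
    (fun a b b' ↦ by
      rw [← inner_add_right, ← map_add]; congr 2; exact map_add _ _ _)
    (fun c a b ↦ by
      rw [smul_eq_mul, ← real_inner_smul_right, ← map_smul]; congr 2; exact map_smul _ _ _)
    ).toContinuousBilinearMap

variable {p₀ : M}

lemma fundamentalForm_apply (z a b : E) : fundamentalForm F p₀ z a b =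
    inner ℝ (chartField p₀ (fun _ ↦ a) ((chartAt E p₀).symm z))
      (F _ (chartField p₀ (fun _ ↦ b) ((chartAt E p₀).symm z))) := rfl

lemma fundamentalForm_skew (hgF : IsAffinorMetric F 1) (z a b : E) :
    fundamentalForm F p₀ z a b = -fundamentalForm F p₀ z b a :=
  inner_affinor_skew hgF _ _

lemma contMDiffAt_affinor_chartField (hF : IsAffinor F) {x : M} (hx : x ∈ (chartAt E p₀).source)
    (a : E) : CMDiffAt ∞ (T% (fun y ↦ F y (chartField p₀ (fun _ ↦ a) y))) x :=
  (hF x).clm_bundle_apply (contMDiffAt_chartField_const hx a)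

variable [IsContMDiffRiemannianBundle 𝓘(ℝ, E) ∞ E (fun x : M ↦ TangentSpace 𝓘(ℝ, E) x)]

lemma contMDiffAt_inner_affinor (hF : IsAffinor F) {x : M} (hx : x ∈ (chartAt E p₀).source)
    (a b : E) : ContMDiffAt 𝓘(ℝ, E) 𝓘(ℝ, ℝ) ∞ (fun y : M ↦ (inner ℝ (chartField p₀ (fun _ ↦ a) y)
      (F y (chartField p₀ (fun _ ↦ b) y)) : ℝ)) x :=
  ContMDiffAt.inner_bundle (F := E) (E := fun x : M ↦ TangentSpace 𝓘(ℝ, E) x) (b := fun y ↦ y)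
    (contMDiffAt_chartField_const hx a) (contMDiffAt_affinor_chartField hF hx b)

lemma contDiffOn_fundamentalForm (hF : IsAffinor F) :
    ContDiffOn ℝ ∞ (fundamentalForm F p₀) (chartAt E p₀).target := by
  rw [contDiffOn_clm_apply]
  intro a
  rw [contDiffOn_clm_apply]
  intro b z hz
  exact (ContMDiffAt.comp z (contMDiffAt_inner_affinor hF ((chartAt E p₀).map_target hz) a b)
    (contMDiffAt_chartAt_symm hz)).contDiffAt.contDiffWithinAt

lemma differentiableAt_fundamentalForm (hF : IsAffinor F) {z : E} (hz : z ∈ (chartAt E p₀).target) :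
    DifferentiableAt ℝ (fundamentalForm F p₀) z :=
  ((contDiffOn_fundamentalForm hF).contDiffAt
    ((chartAt E p₀).open_target.mem_nhds hz)).differentiableAt (by simp)

lemma fderiv_fundamentalForm (hF : IsAffinor F) {z : E} (hz : z ∈ (chartAt E p₀).target)
    (c a b : E) : fderiv ℝ (fundamentalForm F p₀) z c a b =
      mvfderiv 𝓘(ℝ, E) (fun y : M ↦ (inner ℝ (chartField p₀ (fun _ ↦ a) y)
        (F y (chartField p₀ (fun _ ↦ b) y)) : ℝ)) ((chartAt E p₀).symm z)
        (chartField p₀ (fun _ ↦ c) ((chartAt E p₀).symm z)) := by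
  have h1 : HasFDerivAt (fun z' ↦ fundamentalForm F p₀ z' a b)
      (((fderiv ℝ (fundamentalForm F p₀) z).flip a).flip b) z := by
    have := (((differentiableAt_fundamentalForm hF hz).hasFDerivAt.clm_apply
      (hasFDerivAt_const a z)).clm_apply (hasFDerivAt_const b z))
    refine this.congr_fderiv ?_
    ext; simp
  have h2 : mfderiv 𝓘(ℝ, E) 𝓘(ℝ, ℝ) ((fun y : M ↦ (inner ℝ (chartField p₀ (fun _ ↦ a) y)
        (F y (chartField p₀ (fun _ ↦ b) y)) : ℝ)) ∘ (chartAt E p₀).symm) z = _ :=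
    mfderiv_comp z ((contMDiffAt_inner_affinor hF
      ((chartAt E p₀).map_target hz) a b).mdifferentiableAt (by simp))
      ((contMDiffAt_chartAt_symm hz).mdifferentiableAt (by simp))
  rw [mfderiv_eq_fderiv] at h2
  have h3 := congrArg (fun S : E →L[ℝ] ℝ ↦ S c) h2
  rw [← mfderiv_chartAt_symm hz]
  refine Eq.trans ?_ h3
  exact (congrArg (fun S : E →L[ℝ] ℝ ↦ S c) h1.fderiv).symm

/-- The fundamental two-form of a parallel skew-symmetric affinor is closed: for coordinate fields
`X`, `Y`, `Z` one has `X(g(Y, FZ)) = g(∇_X Y, FZ) - g(FY, ∇_X Z)`, and the cyclic sum vanishes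
because `∇_X Y = ∇_Y X`. -/
theorem fderiv_fundamentalForm_cyclic (hF : IsAffinor F) (hgF : IsAffinorMetric F 1)
    {nabla : CovariantDerivative 𝓘(ℝ, E) E (TangentSpace 𝓘(ℝ, E) : M → Type _)}
    (hLC : IsLeviCivita nabla) (hpar : IsParallel nabla F) {z : E}
    (hz : z ∈ (chartAt E p₀).target) (a b c : E) :
    fderiv ℝ (fundamentalForm F p₀) z a b c - fderiv ℝ (fundamentalForm F p₀) z b a c +
      fderiv ℝ (fundamentalForm F p₀) z c a b = 0 := by
  have hp := (chartAt E p₀).map_target hz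
  set p := (chartAt E p₀).symm z with hpdef
  have hd : ∀ a, MDiffAt (T% (chartField p₀ (fun _ ↦ a) : ∀ x : M, TangentSpace 𝓘(ℝ, E) x)) p :=
    fun a ↦ (contMDiffAt_chartField_const hp a).mdifferentiableAt (by simp)
  have hdF : ∀ a, MDiffAt (T% (fun y ↦ F y (chartField p₀ (fun _ ↦ a) y))) p :=
    fun a ↦ (contMDiffAt_affinor_chartField hF hp a).mdifferentiableAt (by simp)
  let N : E → E → TangentSpace 𝓘(ℝ, E) p := fun a b ↦
    nabla (chartField p₀ (fun _ ↦ b)) p (chartField p₀ (fun _ ↦ a) p)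
  have hN : ∀ a b, N a b = N b a := by
    intro a b
    have := (CovariantDerivative.torsion_eq_zero_iff _).1 hLC.1 (hd a) (hd b)
    rw [mlieBracket_chartField_const hp] at this
    exact sub_eq_zero.1 this
  have key : ∀ a b c, fderiv ℝ (fundamentalForm F p₀) z a b c =
      inner ℝ (N a b) (F p (chartField p₀ (fun _ ↦ c) p)) -
        inner ℝ (N a c) (F p (chartField p₀ (fun _ ↦ b) p)) := by
    intro a b c
    rw [fderiv_fundamentalForm hF hz]
    have h := hLC.2.mvfderiv_inner_eq (chartField p₀ (fun _ ↦ a)) (hd b) (hdF c)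
    refine h.trans ?_
    have h2 := hpar p _ (hd c) (chartField p₀ (fun _ ↦ a) p)
    have h3 := inner_affinor_skew hgF (chartField p₀ (fun _ ↦ b) p) (N a c)
    rw [← h2] at h3
    exact (congrArg _ h3).trans (sub_eq_add_neg _ _).symm
  rw [key, key, key, hN b a, hN c a, hN c b]
  ring

end FundamentalForm

/-! ### Immersions in charts -/

section Immersion

variable {E' : Type*} [NormedAddCommGroup E'] [NormedSpace ℝ E']
  {N : Type*} [TopologicalSpace N] [ChartedSpace E' N] [IsManifold 𝓘(ℝ, E') ∞ N]
  {E : Type*} [NormedAddCommGroup E] [NormedSpace ℝ E]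
  {M : Type*} [TopologicalSpace M] [ChartedSpace E M] [IsManifold 𝓘(ℝ, E) ∞ M] {ι : N → M}

lemma mdifferentiable_of_mem_maximalAtlas {e : OpenPartialHomeomorph N E'}
    (h : e ∈ IsManifold.maximalAtlas 𝓘(ℝ, E') ∞ N) :
    e.MDifferentiable 𝓘(ℝ, E') 𝓘(ℝ, E') :=
  ⟨(contMDiffOn_of_mem_maximalAtlas h).mdifferentiableOn (by simp),
    (contMDiffOn_symm_of_mem_maximalAtlas h).mdifferentiableOn (by simp)⟩

lemma injective_mfderiv_of_isImmersion (hι : Manifold.IsImmersion 𝓘(ℝ, E') 𝓘(ℝ, E) ∞ ι) (x : N) :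
    Function.Injective (mfderiv 𝓘(ℝ, E') 𝓘(ℝ, E) ι x) := by
  have h := hι.isImmersionAt x
  have hdom := mdifferentiable_of_mem_maximalAtlas h.domChart_mem_maximalAtlas
  have hcod := mdifferentiable_of_mem_maximalAtlas h.codChart_mem_maximalAtlas
  let L : E' →L[ℝ] E := (h.equiv : (E' × h.complement) →L[ℝ] E) ∘L
    ContinuousLinearMap.inl ℝ E' h.complement
  have hev : h.codChart ∘ ι =ᶠ[𝓝 x] L ∘ h.domChart := by
    filter_upwards [h.domChart.open_source.mem_nhds h.mem_domChart_source] with x' hx'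
    have hx'' : h.domChart x' ∈ (h.domChart.extend 𝓘(ℝ, E')).target := by
      simpa using h.domChart.map_source hx'
    have := h.writtenInCharts hx''
    simpa [hx', L] using this
  have h1 := mfderiv_comp x (hcod.mdifferentiableAt h.mem_codChart_source)
    (hι.contMDiff.contMDiffAt.mdifferentiableAt (by simp) : MDifferentiableAt _ _ ι x)
  have h2 := mfderiv_comp x (L.differentiableAt.mdifferentiableAt)
    (hdom.mdifferentiableAt h.mem_domChart_source)
  rw [hev.mfderiv_eq] at h1
  have h3 := h1.symm.trans h2
  have hL : Function.Injective L := by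
    intro v w hvw
    simpa [L] using hvw
  intro v w hvw
  apply hdom.mfderiv_injective h.mem_domChart_source
  apply hL
  rw [mfderiv_eq_fderiv, L.fderiv] at h3
  have e : ∀ v, mfderiv 𝓘(ℝ, E) 𝓘(ℝ, E) h.codChart (ι x) (mfderiv 𝓘(ℝ, E') 𝓘(ℝ, E) ι x v) =
      L (mfderiv 𝓘(ℝ, E') 𝓘(ℝ, E') h.domChart x v) := fun v ↦
    congrArg (fun S : E' →L[ℝ] E ↦ S v) h3
  exact (e v).symm.trans ((congrArg _ hvw).trans (e w))

/-- The expression of `ι` in the charts at `x₀` and `ι x₀`. -/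
def readMap (ι : N → M) (x₀ : N) (y : E') : E :=
  chartAt E (ι x₀) (ι ((chartAt E' x₀).symm y))

lemma contDiffAt_readMap (hι : ContMDiff 𝓘(ℝ, E') 𝓘(ℝ, E) ∞ ι) {x₀ : N} {y : E'}
    (hy : y ∈ (chartAt E' x₀).target)
    (hy' : ι ((chartAt E' x₀).symm y) ∈ (chartAt E (ι x₀)).source) :
    ContDiffAt ℝ ∞ (readMap (E := E) ι x₀) y :=
  have h : ContMDiffAt 𝓘(ℝ, E') 𝓘(ℝ, E) ∞ (chartAt E (ι x₀) ∘ ι) ((chartAt E' x₀).symm y) :=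
    (contMDiffAt_chartAt hy').comp _ (hι _)
  (h.comp y (contMDiffAt_chartAt_symm hy)).contDiffAt

lemma fderiv_readMap (hι : ContMDiff 𝓘(ℝ, E') 𝓘(ℝ, E) ∞ ι) {x₀ : N} {y : E'}
    (hy : y ∈ (chartAt E' x₀).target)
    (hy' : ι ((chartAt E' x₀).symm y) ∈ (chartAt E (ι x₀)).source) (a : E') :
    fderiv ℝ (readMap ι x₀) y a = chartDeriv (ι x₀) (ι ((chartAt E' x₀).symm y))
      (mfderiv 𝓘(ℝ, E') 𝓘(ℝ, E) ι ((chartAt E' x₀).symm y)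
        (chartField x₀ (fun _ ↦ a) ((chartAt E' x₀).symm y))) := by
  have h1 := mfderiv_comp y ((contMDiffAt_chartAt hy').comp _ (hι _) |>.mdifferentiableAt (by simp))
    ((contMDiffAt_chartAt_symm hy).mdifferentiableAt (by simp))
  have h2 := mfderiv_comp ((chartAt E' x₀).symm y)
    ((contMDiffAt_chartAt hy').mdifferentiableAt (by simp)) ((hι _).mdifferentiableAt (by simp))
  rw [h2, mfderiv_eq_fderiv] at h1
  have h3 := congrArg (fun S : E' →L[ℝ] E ↦ S a) h1
  rw [← mfderiv_chartAt_symm hy]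
  exact h3

end Immersion

/-! ### The kernel of the fundamental form on a submanifold -/

section Kernel

variable {E' : Type*} [NormedAddCommGroup E'] [NormedSpace ℝ E'] [FiniteDimensional ℝ E']
  {N : Type*} [TopologicalSpace N] [ChartedSpace E' N] [IsManifold 𝓘(ℝ, E') ∞ N]
  {E : Type*} [NormedAddCommGroup E] [NormedSpace ℝ E] [FiniteDimensional ℝ E]
  {M : Type*} [TopologicalSpace M] [ChartedSpace E M] [IsManifold 𝓘(ℝ, E) ∞ M] {ι : N → M}
  [Bundle.RiemannianBundle (fun x : M ↦ TangentSpace 𝓘(ℝ, E) x)]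
  {F : ∀ x : M, TangentSpace 𝓘(ℝ, E) x →L[ℝ] TangentSpace 𝓘(ℝ, E) x}

lemma fundamentalForm_readMap (hι : ContMDiff 𝓘(ℝ, E') 𝓘(ℝ, E) ∞ ι) {x₀ : N} {y : E'}
    (hy : y ∈ (chartAt E' x₀).target)
    (hy' : ι ((chartAt E' x₀).symm y) ∈ (chartAt E (ι x₀)).source) (a b : E') :
    fundamentalForm F (ι x₀) (readMap ι x₀ y) (fderiv ℝ (readMap ι x₀) y a)
      (fderiv ℝ (readMap ι x₀) y b) =
    inner ℝ (mfderiv 𝓘(ℝ, E') 𝓘(ℝ, E) ι ((chartAt E' x₀).symm y)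
        (chartField x₀ (fun _ ↦ a) ((chartAt E' x₀).symm y)))
      (F _ (mfderiv 𝓘(ℝ, E') 𝓘(ℝ, E) ι ((chartAt E' x₀).symm y)
        (chartField x₀ (fun _ ↦ b) ((chartAt E' x₀).symm y)))) := by
  rw [fderiv_readMap hι hy hy', fderiv_readMap hι hy hy', fundamentalForm_apply]
  have hp : (chartAt E (ι x₀)).symm (readMap ι x₀ y) = ι ((chartAt E' x₀).symm y) :=
    (chartAt E (ι x₀)).left_inv hy'
  rw [hp, chartField_chartDeriv hy', chartField_chartDeriv hy']

variable [IsContMDiffRiemannianBundle 𝓘(ℝ, E) ∞ E (fun x : M ↦ TangentSpace 𝓘(ℝ, E) x)]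

/-- The kernel of the pullback of the fundamental form to a submanifold is involutive. -/
theorem inner_mfderiv_mlieBracket_eq_zero (hF : IsAffinor F) (hgF : IsAffinorMetric F 1)
    {nabla : CovariantDerivative 𝓘(ℝ, E) E (TangentSpace 𝓘(ℝ, E) : M → Type _)}
    (hLC : IsLeviCivita nabla) (hpar : IsParallel nabla F)
    (hι : ContMDiff 𝓘(ℝ, E') 𝓘(ℝ, E) ∞ ι) {X Y : ∀ x : N, TangentSpace 𝓘(ℝ, E') x} {x₀ : N}
    (hX : CMDiffAt ∞ (T% X) x₀) (hY : CMDiffAt ∞ (T% Y) x₀)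
    (hXk : ∀ᶠ x in 𝓝 x₀, ∀ v : TangentSpace 𝓘(ℝ, E') x,
      inner ℝ (mfderiv 𝓘(ℝ, E') 𝓘(ℝ, E) ι x (X x))
        (F (ι x) (mfderiv 𝓘(ℝ, E') 𝓘(ℝ, E) ι x v)) = 0)
    (hYk : ∀ᶠ x in 𝓝 x₀, ∀ v : TangentSpace 𝓘(ℝ, E') x,
      inner ℝ (mfderiv 𝓘(ℝ, E') 𝓘(ℝ, E) ι x (Y x))
        (F (ι x) (mfderiv 𝓘(ℝ, E') 𝓘(ℝ, E) ι x v)) = 0) (v : TangentSpace 𝓘(ℝ, E') x₀) :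
    inner ℝ (mfderiv 𝓘(ℝ, E') 𝓘(ℝ, E) ι x₀ (VectorField.mlieBracket 𝓘(ℝ, E') X Y x₀))
      (F (ι x₀) (mfderiv 𝓘(ℝ, E') 𝓘(ℝ, E) ι x₀ v)) = 0 := by
  set y₀ := chartAt E' x₀ x₀ with hy₀
  have hx₀ : x₀ ∈ (chartAt E' x₀).source := mem_chart_source _ _
  have hyt : y₀ ∈ (chartAt E' x₀).target := mem_chart_target _ _
  have hinv : (chartAt E' x₀).symm y₀ = x₀ := (chartAt E' x₀).left_inv hx₀
  have hys : ι ((chartAt E' x₀).symm y₀) ∈ (chartAt E (ι x₀)).source := by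
    rw [hinv]; exact mem_chart_source _ _
  have hcont : ContinuousAt (chartAt E' x₀).symm y₀ :=
    (chartAt E' x₀).continuousAt_symm hyt
  have hev : ∀ᶠ y in 𝓝 y₀, y ∈ (chartAt E' x₀).target ∧
      ι ((chartAt E' x₀).symm y) ∈ (chartAt E (ι x₀)).source :=
    ((chartAt E' x₀).open_target.eventually_mem hyt).and
      ((hι.continuous.continuousAt.comp hcont).eventually
        ((chartAt E (ι x₀)).open_source.eventually_mem hys))
  -- The fields read in the chart are in the kernel of the pulled back form.
  have hker : ∀ Z : ∀ x : N, TangentSpace 𝓘(ℝ, E') x,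
      (∀ᶠ x in 𝓝 x₀, ∀ v : TangentSpace 𝓘(ℝ, E') x,
        inner ℝ (mfderiv 𝓘(ℝ, E') 𝓘(ℝ, E) ι x (Z x))
          (F (ι x) (mfderiv 𝓘(ℝ, E') 𝓘(ℝ, E) ι x v)) = 0) →
      ∀ᶠ y in 𝓝 y₀, ∀ u, fundamentalForm F (ι x₀) (readMap ι x₀ y)
        (fderiv ℝ (readMap ι x₀) y (readField x₀ Z y)) (fderiv ℝ (readMap ι x₀) y u) = 0 := by
    intro Z hZ
    rw [← hinv] at hZ
    filter_upwards [hev, hcont.eventually hZ] with y hy hyZ u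
    rw [fundamentalForm_readMap hι hy.1 hy.2]
    have : chartField x₀ (fun _ ↦ readField x₀ Z y) ((chartAt E' x₀).symm y) =
        Z ((chartAt E' x₀).symm y) :=
      chartField_chartDeriv ((chartAt E' x₀).map_target hy.1) _
    rw [this]
    exact hyZ _
  have hdiff : ∀ {Z : ∀ x : N, TangentSpace 𝓘(ℝ, E') x}, CMDiffAt ∞ (T% Z) x₀ →
      ContDiffAt ℝ ∞ (readField x₀ Z) y₀ := fun {Z} hZ ↦
    contDiffAt_readField hyt (by rw [hinv]; exact hZ)
  have hbr : VectorField.mlieBracket 𝓘(ℝ, E') X Y x₀ =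
      chartField x₀ (VectorField.lieBracket ℝ (readField x₀ X) (readField x₀ Y)) x₀ := by
    rw [← mlieBracket_chartField hx₀ (hdiff hX) (hdiff hY)]
    refine (Filter.EventuallyEq.mlieBracket_vectorField_eq ?_ ?_).symm <;>
    filter_upwards [(chartAt E' x₀).open_source.mem_nhds hx₀] with x hx
    exacts [chartField_readField hx X, chartField_readField hx Y]
  have hrt : readMap ι x₀ y₀ ∈ (chartAt E (ι x₀)).target := (chartAt E (ι x₀)).map_source hys
  have h := apply_fderiv_lieBracket_eq_zero
    ((contDiffAt_readMap hι hyt hys).of_le two_le_infty) (differentiableAt_fundamentalForm hF hrt)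
    (fundamentalForm_skew hgF _) (fderiv_fundamentalForm_cyclic hF hgF hLC hpar hrt)
    ((hdiff hX).differentiableAt (by simp)) ((hdiff hY).differentiableAt (by simp))
    (hker X hXk) (hker Y hYk) (chartDeriv x₀ x₀ v)
  rw [fundamentalForm_readMap hι hyt hys, hinv, chartField_chartDeriv hx₀] at h
  rw [hbr]
  exact h

end Kernel

/-! ### The anti-invariant distribution -/

section AntiInvariant

variable {E' : Type*} [NormedAddCommGroup E'] [NormedSpace ℝ E']
  {N : Type*} [TopologicalSpace N] [ChartedSpace E' N] [IsManifold 𝓘(ℝ, E') ∞ N]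
  {E : Type*} [NormedAddCommGroup E] [NormedSpace ℝ E]
  {M : Type*} [TopologicalSpace M] [ChartedSpace E M] [IsManifold 𝓘(ℝ, E) ∞ M] {ι : N → M}
  [Bundle.RiemannianBundle (fun x : M ↦ TangentSpace 𝓘(ℝ, E) x)]
  {F : ∀ x : M, TangentSpace 𝓘(ℝ, E) x →L[ℝ] TangentSpace 𝓘(ℝ, E) x}
  {D : ∀ x : N, Submodule ℝ (TangentSpace 𝓘(ℝ, E') x)}

lemma mem_orthDistribution_iff {x : N} {v : TangentSpace 𝓘(ℝ, E') x} :
    v ∈ orthDistribution 𝓘(ℝ, E) 𝓘(ℝ, E') ι D x ↔ ∀ d ∈ D x,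
      inner ℝ (mfderiv 𝓘(ℝ, E') 𝓘(ℝ, E) ι x d) (mfderiv 𝓘(ℝ, E') 𝓘(ℝ, E) ι x v) = 0 := by
  rw [orthDistribution, Submodule.mem_comap, Submodule.mem_orthogonal]
  exact ⟨fun h d hd ↦ h _ (Submodule.mem_map_of_mem hd), fun h ↦ by
    rintro _ ⟨d, hd, rfl⟩; exact h d hd⟩

/-- For a semi-invariant submanifold, `D^⊥` is the kernel of the pullback of the form
`(v, w) ↦ g(v, F w)`: it lies in the kernel because `F(D^⊥)` is normal, and a vector of the kernel
is orthogonal to `F(D)`, which is all of `D` since `F` is injective. -/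
theorem mem_orthDistribution_iff_inner_affinor [FiniteDimensional ℝ E'] (hgF : IsAffinorMetric F 1)
    (hnd : IsNondegenerate F) (hD : IsSemiInvariant 𝓘(ℝ, E') F ι D) {x : N}
    {v : TangentSpace 𝓘(ℝ, E') x} :
    v ∈ orthDistribution 𝓘(ℝ, E) 𝓘(ℝ, E') ι D x ↔ ∀ w : TangentSpace 𝓘(ℝ, E') x,
      inner ℝ (mfderiv 𝓘(ℝ, E') 𝓘(ℝ, E) ι x v)
        (F (ι x) (mfderiv 𝓘(ℝ, E') 𝓘(ℝ, E) ι x w)) = 0 := by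
  constructor
  · intro hv w
    have h1 := hD.antiInvariant x (Submodule.mem_map_of_mem (Submodule.mem_map_of_mem hv))
    rw [normalSpace, Submodule.mem_orthogonal] at h1
    have h2 := h1 _ (LinearMap.mem_range_self _ w)
    rw [inner_affinor_skew hgF, neg_eq_zero]
    exact h2
  · intro hv
    rw [mem_orthDistribution_iff]
    intro d hd
    have : FiniteDimensional ℝ (TangentSpace 𝓘(ℝ, E') x) := inferInstanceAs (FiniteDimensional ℝ E')
    have hmaps : ∀ u ∈ (D x).map (dmap 𝓘(ℝ, E) 𝓘(ℝ, E') ι x),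
        (F (ι x)).toLinearMap u ∈ (D x).map (dmap 𝓘(ℝ, E) 𝓘(ℝ, E') ι x) := fun u hu ↦
      hD.invariant x (Submodule.mem_map_of_mem hu)
    have hinj : Function.Injective ((F (ι x)).toLinearMap.restrict hmaps) := fun a b hab ↦
      Subtype.ext ((hnd (ι x)).1 (congrArg Subtype.val hab))
    obtain ⟨⟨_, d', hd', rfl⟩, hdd'⟩ := LinearMap.injective_iff_surjective.1 hinj
      ⟨_, Submodule.mem_map_of_mem hd⟩
    have h1 : F (ι x) (mfderiv 𝓘(ℝ, E') 𝓘(ℝ, E) ι x d') = mfderiv 𝓘(ℝ, E') 𝓘(ℝ, E) ι x d :=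
      congrArg Subtype.val hdd'
    rw [← h1, real_inner_comm]
    exact hv d'

/-- The anti-invariant distribution of a semi-invariant submanifold is involutive. -/
theorem isInvolutive_orthDistribution [FiniteDimensional ℝ E'] [FiniteDimensional ℝ E]
    [IsContMDiffRiemannianBundle 𝓘(ℝ, E) ∞ E (fun x : M ↦ TangentSpace 𝓘(ℝ, E) x)]
    (hF : IsAffinor F) (hgF : IsAffinorMetric F 1) (hnd : IsNondegenerate F)
    {nabla : CovariantDerivative 𝓘(ℝ, E) E (TangentSpace 𝓘(ℝ, E) : M → Type _)}
    (hLC : IsLeviCivita nabla) (hpar : IsParallel nabla F)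
    (hι : ContMDiff 𝓘(ℝ, E') 𝓘(ℝ, E) ∞ ι) (hD : IsSemiInvariant 𝓘(ℝ, E') F ι D) :
    IsInvolutive 𝓘(ℝ, E') (orthDistribution 𝓘(ℝ, E) 𝓘(ℝ, E') ι D) := by
  intro U X Y hU hX hY hXD hYD x hx
  have hUx := hU.mem_nhds hx
  rw [mem_orthDistribution_iff_inner_affinor hgF hnd hD]
  refine inner_mfderiv_mlieBracket_eq_zero hF hgF hLC hpar hι (hX.contMDiffAt hUx)
    (hY.contMDiffAt hUx) ?_ ?_
  · filter_upwards [hUx] with x' hx'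
    exact (mem_orthDistribution_iff_inner_affinor hgF hnd hD).1 (hXD x' hx')
  · filter_upwards [hUx] with x' hx'
    exact (mem_orthDistribution_iff_inner_affinor hgF hnd hD).1 (hYD x' hx')

/-- The one-forms `w ↦ g(s_i, w)`, read in the chart at `x₀`. -/
def coframe [FiniteDimensional ℝ E'] (ι : N → M) (x₀ : N) {k : ℕ}
    (s : Fin k → ∀ x : N, TangentSpace 𝓘(ℝ, E') x) (y : E') : E' →L[ℝ] (Fin k → ℝ) :=
  ContinuousLinearMap.pi fun i ↦ LinearMap.toContinuousLinearMap
    { toFun := fun w ↦ inner ℝ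
        (mfderiv 𝓘(ℝ, E') 𝓘(ℝ, E) ι ((chartAt E' x₀).symm y) (s i ((chartAt E' x₀).symm y)))
        (mfderiv 𝓘(ℝ, E') 𝓘(ℝ, E) ι ((chartAt E' x₀).symm y)
          (chartField x₀ (fun _ ↦ w) ((chartAt E' x₀).symm y)))
      map_add' := fun v w ↦ by
        rw [← inner_add_right, ← map_add]; congr 2; exact map_add _ _ _
      map_smul' := fun c w ↦ by
        rw [RingHom.id_apply, smul_eq_mul, ← real_inner_smul_right, ← map_smul]; congr 2
        exact map_smul _ _ _ }

lemma coframe_apply [FiniteDimensional ℝ E'] (x₀ : N) {k : ℕ}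
    (s : Fin k → ∀ x : N, TangentSpace 𝓘(ℝ, E') x) (y w : E') (i : Fin k) :
    coframe (E := E) ι x₀ s y w i = inner ℝ
        (mfderiv 𝓘(ℝ, E') 𝓘(ℝ, E) ι ((chartAt E' x₀).symm y) (s i ((chartAt E' x₀).symm y)))
        (mfderiv 𝓘(ℝ, E') 𝓘(ℝ, E) ι ((chartAt E' x₀).symm y)
          (chartField x₀ (fun _ ↦ w) ((chartAt E' x₀).symm y))) := rfl

lemma coframe_chartDeriv [FiniteDimensional ℝ E'] {x₀ x : N} (hx : x ∈ (chartAt E' x₀).source)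
    {k : ℕ} (s : Fin k → ∀ x : N, TangentSpace 𝓘(ℝ, E') x) (v : TangentSpace 𝓘(ℝ, E') x)
    (i : Fin k) :
    coframe (E := E) ι x₀ s (chartAt E' x₀ x) (chartDeriv x₀ x v) i = inner ℝ
      (mfderiv 𝓘(ℝ, E') 𝓘(ℝ, E) ι x (s i x)) (mfderiv 𝓘(ℝ, E') 𝓘(ℝ, E) ι x v) := by
  rw [coframe_apply, (chartAt E' x₀).left_inv hx, chartField_chartDeriv hx]

lemma contMDiffAt_mfderiv_apply (hι : ContMDiff 𝓘(ℝ, E') 𝓘(ℝ, E) ∞ ι)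
    {X : ∀ x : N, TangentSpace 𝓘(ℝ, E') x} {x : N} (hX : CMDiffAt ∞ (T% X) x) :
    ContMDiffAt 𝓘(ℝ, E') 𝓘(ℝ, E).tangent ∞ (fun x ↦ (⟨ι x, mfderiv 𝓘(ℝ, E') 𝓘(ℝ, E) ι x (X x)⟩ :
      Bundle.TotalSpace E (fun x : M ↦ TangentSpace 𝓘(ℝ, E) x))) x :=
  ((hι.contMDiff_tangentMap (m := ∞) (by simp)).contMDiffAt).comp x hX

lemma contDiffOn_coframe [FiniteDimensional ℝ E']
    [IsContMDiffRiemannianBundle 𝓘(ℝ, E) ∞ E (fun x : M ↦ TangentSpace 𝓘(ℝ, E) x)]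
    (hι : ContMDiff 𝓘(ℝ, E') 𝓘(ℝ, E) ∞ ι) {x₀ : N} {V : Set E'} (hV : V ⊆ (chartAt E' x₀).target)
    {k : ℕ} {s : Fin k → ∀ x : N, TangentSpace 𝓘(ℝ, E') x}
    (hs : ∀ y ∈ V, ∀ i, CMDiffAt ∞ (T% (s i)) ((chartAt E' x₀).symm y)) :
    ContDiffOn ℝ ∞ (coframe (E := E) ι x₀ s) V := by
  rw [contDiffOn_clm_apply]
  intro w
  rw [contDiffOn_pi]
  intro i y hyV
  have hy := hV hyV
  have h : ContMDiffAt 𝓘(ℝ, E') 𝓘(ℝ, ℝ) ∞ (fun x ↦ (inner ℝ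
      (mfderiv 𝓘(ℝ, E') 𝓘(ℝ, E) ι x (s i x))
      (mfderiv 𝓘(ℝ, E') 𝓘(ℝ, E) ι x (chartField x₀ (fun _ ↦ w) x)) : ℝ))
      ((chartAt E' x₀).symm y) :=
    ContMDiffAt.inner_bundle (F := E) (E := fun x : M ↦ TangentSpace 𝓘(ℝ, E) x) (b := ι)
      (contMDiffAt_mfderiv_apply hι (hs y hyV i))
      (contMDiffAt_mfderiv_apply hι
        (contMDiffAt_chartField_const ((chartAt E' x₀).map_target hy) w))
  exact (h.comp y (contMDiffAt_chartAt_symm hy)).contDiffAt.contDiffWithinAt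

lemma surjective_coframe [FiniteDimensional ℝ E'] {x₀ x : N} (hx : x ∈ (chartAt E' x₀).source)
    (hι : Function.Injective (mfderiv 𝓘(ℝ, E') 𝓘(ℝ, E) ι x)) {k : ℕ}
    {s : Fin k → ∀ x : N, TangentSpace 𝓘(ℝ, E') x}
    (hs : LinearIndependent ℝ (fun i ↦ s i x)) :
    Function.Surjective (coframe (E := E) ι x₀ s (chartAt E' x₀ x)) := by
  let G : (Fin k → ℝ) →ₗ[ℝ] (Fin k → ℝ) :=
    (coframe (E := E) ι x₀ s (chartAt E' x₀ x)).toLinearMap ∘ₗ (chartDeriv x₀ x).toLinearMap ∘ₗ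
      Fintype.linearCombination ℝ (fun i ↦ s i x)
  have hG : Function.Injective G := by
    rw [injective_iff_map_eq_zero]
    intro c hc
    set u := Fintype.linearCombination ℝ (fun i ↦ s i x) c with hu
    have h1 : ∀ i, inner ℝ (mfderiv 𝓘(ℝ, E') 𝓘(ℝ, E) ι x (s i x))
        (mfderiv 𝓘(ℝ, E') 𝓘(ℝ, E) ι x u) = 0 := fun i ↦
      (coframe_chartDeriv hx s u i).symm.trans (congrFun hc i)
    have h2 : inner ℝ (mfderiv 𝓘(ℝ, E') 𝓘(ℝ, E) ι x u)
        (mfderiv 𝓘(ℝ, E') 𝓘(ℝ, E) ι x u) = 0 := by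
      nth_rewrite 1 [hu]
      rw [Fintype.linearCombination_apply, map_sum, sum_inner]
      refine Finset.sum_eq_zero fun i _ ↦ ?_
      rw [map_smul, real_inner_smul_left, h1, mul_zero]
    have h3 : u = 0 := hι ((inner_self_eq_zero.1 h2).trans (map_zero _).symm)
    rw [hu, Fintype.linearCombination_apply] at h3
    exact funext (Fintype.linearIndependent_iff.1 hs c h3)
  intro b
  obtain ⟨c, hc⟩ := LinearMap.injective_iff_surjective.1 hG b
  exact ⟨_, hc⟩

lemma mem_orthDistribution_iff_coframe [FiniteDimensional ℝ E'] {x₀ x : N}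
    (hx : x ∈ (chartAt E' x₀).source) {k : ℕ} {s : Fin k → ∀ x : N, TangentSpace 𝓘(ℝ, E') x}
    (hs : Submodule.span ℝ (Set.range fun i ↦ s i x) = D x) {v : TangentSpace 𝓘(ℝ, E') x} :
    v ∈ orthDistribution 𝓘(ℝ, E) 𝓘(ℝ, E') ι D x ↔
      coframe (E := E) ι x₀ s (chartAt E' x₀ x) (chartDeriv x₀ x v) = 0 := by
  rw [mem_orthDistribution_iff, ← hs]
  constructor
  · intro h
    funext i
    rw [coframe_chartDeriv hx]
    exact h _ (Submodule.subset_span (mem_range_self i))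
  · intro h d hd
    induction hd using Submodule.span_induction with
    | mem d hd =>
      obtain ⟨i, rfl⟩ := hd
      exact (coframe_chartDeriv hx s v i).symm.trans (congrFun h i)
    | zero => rw [map_zero, inner_zero_left]
    | add a b _ _ ha hb => rw [map_add, inner_add_left, ha, hb, add_zero]
    | smul c a _ ha => rw [map_smul, real_inner_smul_left, ha, mul_zero]

/-- If `D^⊥` is involutive, it is tangent to a foliation: a local frame of `D` provides the coframe
with kernel `D^⊥` to which the Frobenius theorem applies. -/
theorem isIntegrable_orthDistribution {m n : ℕ} {M : Type*} [TopologicalSpace M]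
    [ChartedSpace (EuclideanSpace ℝ (Fin m)) M] [IsManifold (𝓡 m) ∞ M]
    [Bundle.RiemannianBundle (fun x : M ↦ TangentSpace (𝓡 m) x)]
    [IsContMDiffRiemannianBundle (𝓡 m) ∞ (EuclideanSpace ℝ (Fin m))
      (fun x : M ↦ TangentSpace (𝓡 m) x)]
    {F : ∀ x : M, TangentSpace (𝓡 m) x →L[ℝ] TangentSpace (𝓡 m) x}
    {N : Type*} [TopologicalSpace N] [ChartedSpace (EuclideanSpace ℝ (Fin n)) N]
    [IsManifold (𝓡 n) ∞ N] {ι : N → M} (hι : Manifold.IsImmersion (𝓡 n) (𝓡 m) ∞ ι)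
    {D : ∀ x : N, Submodule ℝ (TangentSpace (𝓡 n) x)} (hD : IsSemiInvariant (𝓡 n) F ι D)
    (hinv : IsInvolutive (𝓡 n) (orthDistribution (𝓡 m) (𝓡 n) ι D)) :
    IsIntegrable (orthDistribution (𝓡 m) (𝓡 n) ι D) := by
  refine isIntegrable_of_isInvolutive hinv fun x₀ ↦ ?_
  obtain ⟨U, hU, hx₀, k, s, hs, hsD⟩ := hD.isDistribution x₀
  set c := chartAt (EuclideanSpace ℝ (Fin n)) x₀ with hc
  have hx₀c : x₀ ∈ c.source := mem_chart_source _ _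
  refine ⟨k, c.target ∩ c.symm ⁻¹' U, coframe (E := EuclideanSpace ℝ (Fin m)) ι x₀ s,
    c.isOpen_inter_preimage_symm hU, inter_subset_left, ⟨c.map_source hx₀c, ?_⟩, ?_, ?_, ?_⟩
  · rwa [mem_preimage, c.left_inv hx₀c]
  · exact contDiffOn_coframe hι.contMDiff inter_subset_left fun y hy i ↦
      (hs i).contMDiffAt (hU.mem_nhds hy.2)
  · exact surjective_coframe hx₀c (injective_mfderiv_of_isImmersion hι x₀) (hsD x₀ hx₀).1
  · intro x hx hxU v
    have hxU' : x ∈ U := by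
      have := hxU.2
      rwa [mem_preimage, c.left_inv hx] at this
    exact mem_orthDistribution_iff_coframe hx (hsD x hxU').2

end AntiInvariant

end AffinorGeometry

end

theorem theorem4p4
    {m : ℕ} {M : Type*} [TopologicalSpace M] [T2Space M] [SecondCountableTopology M]
    [ChartedSpace (EuclideanSpace ℝ (Fin m)) M] [IsManifold (𝓡 m) ∞ M]
    [Bundle.RiemannianBundle (fun x : M ↦ TangentSpace (𝓡 m) x)]
    [IsContMDiffRiemannianBundle (𝓡 m) ∞ (EuclideanSpace ℝ (Fin m))
      (fun x : M ↦ TangentSpace (𝓡 m) x)]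
    (F : ∀ x : M, TangentSpace (𝓡 m) x →L[ℝ] TangentSpace (𝓡 m) x)
    (hF : AffinorGeometry.IsAffinor F)
    (hgF : AffinorGeometry.IsAffinorMetric F 1)
    (hnd : AffinorGeometry.IsNondegenerate F)
    (nabla : CovariantDerivative (𝓡 m) (EuclideanSpace ℝ (Fin m))
      (TangentSpace (𝓡 m) : M → Type _))
    (hLC : AffinorGeometry.IsLeviCivita nabla)
    (hpar : AffinorGeometry.IsParallel nabla F)
    {n : ℕ} {N : Type*} [TopologicalSpace N] [T2Space N] [SecondCountableTopology N]
    [ChartedSpace (EuclideanSpace ℝ (Fin n)) N] [IsManifold (𝓡 n) ∞ N]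
    (ι : N → M) (hι : Manifold.IsImmersion (𝓡 n) (𝓡 m) ∞ ι)
    (D : ∀ x : N, Submodule ℝ (TangentSpace (𝓡 n) x))
    (hD : AffinorGeometry.IsSemiInvariant (𝓡 n) F ι D) :
    AffinorGeometry.IsInvolutive (𝓡 n) (AffinorGeometry.orthDistribution (𝓡 m) (𝓡 n) ι D) ∧
    AffinorGeometry.IsIntegrable (AffinorGeometry.orthDistribution (𝓡 m) (𝓡 n) ι D) := by
  have hinv := AffinorGeometry.isInvolutive_orthDistribution hF hgF hnd hLC hpar hι.contMDiff hD
  exact ⟨hinv, AffinorGeometry.isIntegrable_orthDistribution hι hD hinv⟩
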